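/- Let $\mathcal H$ be a complex Hilbert space (inner products are linear in the first argument). Let $\mathfrak A(\mathcal H)$ be the CAR algebra, i.e. the universal unital $C^*$-algebra generated by elements $a(h)$, $h\in\mathcal H$, such that $h\mapsto a^*(h):=a(h)^*$ is linear and $$a(h)a(k)+a(k)a(h)=0,\qquad a^*(h)a(k)+a(k)a^*(h)=\langle h,k\rangle 1 .$$ For a unitary $U$ on $\mathcal H$ let $\gamma_U$ be the $*$-automorphism of $\mathfrak A(\mathcal H)$ with $\gamma_U(a(h))=a(Uh)$, and let $\mathfrak I(\mathcal H)=\{x\in\mathfrak A(\mathcal H):\gamma_{\lambda 1}(x)=x\text{ for all }|\lambda|=1\}$ be the gauge-invariant CAR algebra; each $\gamma_U$ maps $\mathfrak I(\mathcal H)$ onto itself. Let $K$ be a bounded operator on $\mathcal H$ with $0\le K\le 1$, let $\varphi_K$ be the quasi-free state on $\mathfrak A(\mathcal H)$ with symbol $K$, i.e. the state with $$\varphi_K(a^*(h_n)\cdots a^*(h_1)a(k_1)\cdots a(k_m))=\delta_{n,m}\det[\langle Kh_i,k_j\rangle]_{i,j=1}^n\qquad(n,m\ge 0),$$ and let $(\rho_K,\mathcal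 H_K,\Omega_K)$ be a GNS triple of $\varphi_K|_{\mathfrak I(\mathcal H)}$: a unital $*$-representation $\rho_K$ of $\mathfrak I(\mathcal H)$ on a Hilbert space $\mathcal H_K$ and a vector $\Omega_K\in\mathcal H_K$ such that $\rho_K(\mathfrak I(\mathcal H))\Omega_K$ is dense and $\langle\rho_K(x)\Omega_K,\Omega_K\rangle=\varphi_K(x)$ for all $x\in\mathfrak I(\mathcal H)$. Let $A$ be a (possibly unbounded) self-adjoint operator on $\mathcal H$ that commutes with $K$ (that is, $K\,\mathrm{dom}(A)\subset\mathrm{dom}(A)$ and $AKx=KAx$ for $x\in\mathrm{dom}(A)$), and let $(U_t)_{t\in\mathbb R}$, $U_t=e^{\mathrm itA}$, be the strongly continuous one-parameter unitary group generated by $A$. Then: 1. There is a unique strongly continuous one-parameter group $(\Gamma_K(U_t))_{t\in\mathbb R}$ of unitary operators on $\mathcal H_K$ such that $\Gamma_K(U_t)\rho_K(x)\Omega_K=\rho_K(\gamma_{U_t}(x))\Omega_K$ for all $t\in\mathbb R$ and $x\in\mathfrak I(\mathcal H)$. 2. Let $d\Gamma_K(A)$ be the infinitesimal generator of $(\Gamma_K(U_t))_{t\in\mathbb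 R}$, normalised by $\Gamma_K(U_t)=e^{\mathrm it\,d\Gamma_K(A)}$. If $\mathcal V$ is a dense linear subspace of $\mathcal H$ with $\mathcal V\subset\mathrm{dom}(A)$ and $U_t\mathcal V\subset\mathcal V$ for all $t\in\mathbb R$, then $$\widetilde{\mathcal V}:=\mathrm{span}\{\rho_K(a^*(h_1)\cdots a^*(h_n)a(k_1)\cdots a(k_n))\Omega_K : n\ge 0,\ h_1,\dots,h_n,k_1,\dots,k_n\in\mathcal V\}$$ is a core for $d\Gamma_K(A)$, i.e. it is contained in $\mathrm{dom}(d\Gamma_K(A))$ and the closure of the restriction of $d\Gamma_K(A)$ to it is $d\Gamma_K(A)$. -/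

import Mathlib

open scoped ENNReal ComplexOrder

noncomputable section

universe u

namespace GICAR

/-! ### Strongly continuous one-parameter unitary groups and their generators -/

/-- A strongly continuous one-parameter group of unitary operators on `E`. -/
@[ext]
structure UnitaryGroup (E : Type*) [NormedAddCommGroup E] [InnerProductSpace ℂ E] where
  toFun : ℝ → (E ≃ₗᵢ[ℂ] E)
  map_zero' : ∀ x, toFun 0 x = x
  map_add' : ∀ s t x, toFun (s + t) x = toFun s (toFun t x)
  continuous' : ∀ x, Continuous fun t => toFun t x

namespace UnitaryGroup

variable {E : Type*} [NormedAddCommGroup E] [InnerProductSpace ℂ E]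

instance : CoeFun (UnitaryGroup E) fun _ => ℝ → (E ≃ₗᵢ[ℂ] E) := ⟨UnitaryGroup.toFun⟩

/-- The infinitesimal generator `B` of `U`, normalised so that `U t = exp (i t B)`: its domain
consists of those `x` for which `t ↦ U t x` is differentiable at `0`, and
`B x = -i (d/dt) U t x` at `t = 0`. -/
def generator (U : UnitaryGroup E) : E →ₗ.[ℂ] E where
  domain :=
    { carrier := {x | DifferentiableAt ℝ (fun t : ℝ => U t x) 0}
      zero_mem' := by simp
      add_mem' := fun {x y} hx hy => by
        have h : DifferentiableAt ℝ (fun t : ℝ => U t x + U t y) 0 := DifferentiableAt.fun_add hx hy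
        simp only [← map_add] at h
        exact h
      smul_mem' := fun c x hx => by
        have h : DifferentiableAt ℝ (fun t : ℝ => c • U t x) 0 := DifferentiableAt.fun_const_smul hx c
        simp only [← map_smul] at h
        exact h }
  toFun :=
    { toFun := fun x => (-Complex.I) • deriv (fun t : ℝ => U t (x : E)) 0
      map_add' := fun x y => by
        have h := deriv_fun_add (𝕜 := ℝ) (show DifferentiableAt ℝ (fun t : ℝ => U t x) 0 from x.2)
          (show DifferentiableAt ℝ (fun t : ℝ => U t y) 0 from y.2)
        simp only [← map_add] at h
        rw [← smul_add, ← h]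
        rfl
      map_smul' := fun c x => by
        have h := deriv_fun_const_smul (𝕜 := ℝ) c
          (show DifferentiableAt ℝ (fun t : ℝ => U t x) 0 from x.2)
        simp only [← map_smul] at h
        rw [RingHom.id_apply, smul_comm c, ← h]
        rfl }

end UnitaryGroup

/-! ### The CAR algebra -/

section CAR

/-- In a `C*`-algebra, `x* x + x x* = r²` implies `‖x‖ ≤ r`. -/
theorem norm_le_of_anticomm {A : Type*} [CStarAlgebra A] [Nontrivial A] {x : A} {r : ℝ}
    (hr : 0 ≤ r) (e : star x * x + x * star x = ((r : ℂ) ^ 2) • (1 : A)) : ‖x‖ ≤ r := by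
  let _ := CStarAlgebra.spectralOrder A
  let _ := CStarAlgebra.spectralOrderedRing A
  have h1 : star x * x ≤ algebraMap ℝ A (r ^ 2) := by
    have e2 : algebraMap ℝ A (r ^ 2) = star x * x + x * star x := by
      rw [e, Algebra.algebraMap_eq_smul_one]
      norm_cast
    rw [e2]
    exact le_add_of_nonneg_right (mul_star_self_nonneg _)
  have h2 := CStarAlgebra.norm_le_norm_of_nonneg_of_le (star_mul_self_nonneg x) h1
  rw [CStarRing.norm_star_mul_self, norm_algebraMap', Real.norm_of_nonneg (by positivity),
    ← sq] at h2
  exact le_of_sq_le_sq h2 hr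

variable (H : Type u) [NormedAddCommGroup H] [InnerProductSpace ℂ H]

/-- A representation of the canonical anticommutation relations over `H` in a nonzero unital
`C*`-algebra. Mathlib's inner product is linear in the second argument, so the inner product of
`h` and `k` that is linear in `h` is `inner ℂ k h`. -/
structure CARRep where
  carrier : Type u
  [cstar : CStarAlgebra carrier]
  [nontriv : Nontrivial carrier]
  ann : H →ₗ⋆[ℂ] carrier
  ann_mul_ann : ∀ h k, ann h * ann k + ann k * ann h = 0
  star_ann_mul_ann : ∀ h k,
    star (ann h) * ann k + ann k * star (ann h) = (inner ℂ k h : ℂ) • (1 : carrier)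

attribute [instance] CARRep.cstar CARRep.nontriv

variable {H}

/-- The relations bound the annihilation operators. -/
theorem CARRep.norm_ann_le (π : CARRep H) (h : H) : ‖π.ann h‖ ≤ ‖h‖ := by
  refine norm_le_of_anticomm (norm_nonneg _) ?_
  rw [π.star_ann_mul_ann, inner_self_eq_norm_sq_to_K]
  rfl

variable (H)

/-- The bounded families indexed by all representations of the relations. -/
abbrev CARProduct : Type (u + 1) := lp (fun π : CARRep H => π.carrier) ∞

instance : CStarAlgebra (CARProduct H) where

variable {H}

/-- The direct sum of all representations. -/
def annProd (h : H) : CARProduct H :=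
  ⟨fun π => π.ann h, memℓp_infty ⟨‖h‖, by rintro _ ⟨π, rfl⟩; exact π.norm_ann_le h⟩⟩

variable (H)

/-- The CAR algebra over `H`: the universal unital `C*`-algebra generated by the annihilation
operators, i.e. the `C*`-algebra generated by the direct sum of all representations of the
relations. -/
def carSubalgebra : StarSubalgebra ℂ (CARProduct H) :=
  (StarAlgebra.adjoin ℂ (Set.range (annProd (H := H)))).topologicalClosure

instance : IsClosed (carSubalgebra H : Set (CARProduct H)) :=
  StarSubalgebra.isClosed_topologicalClosure _

/-- The CAR algebra over `H`. -/
abbrev CAR : Type (u + 1) := carSubalgebra H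

variable {H}

/-- The annihilation operator `a(h)`; the creation operator `a*(h)` is `star (a h)`. -/
def a (h : H) : CAR H :=
  ⟨annProd h, StarSubalgebra.le_topologicalClosure _ (StarAlgebra.subset_adjoin ℂ _ ⟨h, rfl⟩)⟩

theorem a_mul_a (h k : H) : a h * a k + a k * a h = 0 := by
  ext π
  exact π.ann_mul_ann h k

theorem star_a_mul_a (h k : H) :
    star (a h) * a k + a k * star (a h) = (inner ℂ k h : ℂ) • (1 : CAR H) := by
  ext π
  exact π.star_ann_mul_ann h k

theorem a_smul (c : ℂ) (h : H) : a (c • h) = star c • a h := by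
  ext π
  exact π.ann.map_smulₛₗ c h

/-- The universal property: the homomorphism out of the CAR algebra given by a representation. -/
def CAR.lift (π : CARRep H) : CAR H →⋆ₐ[ℂ] π.carrier where
  toFun x := (x : CARProduct H) π
  map_one' := rfl
  map_mul' _ _ := rfl
  map_zero' := rfl
  map_add' _ _ := rfl
  commutes' _ := rfl
  map_star' _ := rfl

theorem CAR.lift_a (π : CARRep H) (h : H) : CAR.lift π (a h) = π.ann h := rfl

/-! ### Bogoliubov automorphisms and the gauge-invariant algebra -/

/-- Composition of a representation with a unitary of the one-particle space. -/
def CARRep.comp (π : CARRep H) (U : H ≃ₗᵢ[ℂ] H) : CARRep H where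
  carrier := π.carrier
  ann := π.ann ∘ₛₗ (U.toLinearEquiv : H →ₗ[ℂ] H)
  ann_mul_ann h k := π.ann_mul_ann _ _
  star_ann_mul_ann h k := by
    simpa using π.star_ann_mul_ann (U h) (U k)

/-- The action of a unitary on bounded families, by permuting the representations. -/
def bogoliubovProd (U : H ≃ₗᵢ[ℂ] H) : CARProduct H →⋆ₐ[ℂ] CARProduct H where
  toFun x := ⟨fun π => (x (π.comp U) : π.carrier), memℓp_infty ⟨‖x‖, by
    rintro _ ⟨π, rfl⟩
    exact lp.norm_apply_le_norm ENNReal.top_ne_zero x (π.comp U)⟩⟩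
  map_one' := rfl
  map_mul' _ _ := rfl
  map_zero' := rfl
  map_add' _ _ := rfl
  commutes' _ := rfl
  map_star' _ := rfl

theorem bogoliubovProd_mem (U : H ≃ₗᵢ[ℂ] H) (x : CAR H) :
    bogoliubovProd U x ∈ carSubalgebra H := by
  have hc : Continuous (bogoliubovProd U) := 
    AddMonoidHomClass.continuous_of_bound (bogoliubovProd U) 1 fun x => by
      rw [one_mul]
      exact lp.norm_le_of_forall_le (norm_nonneg x) fun π =>
        lp.norm_apply_le_norm ENNReal.top_ne_zero x (π.comp U)
  have h : carSubalgebra H ≤ (carSubalgebra H).comap (bogoliubovProd U) := by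
    refine StarSubalgebra.topologicalClosure_minimal (StarAlgebra.adjoin_le ?_) ?_
    · rintro _ ⟨h, rfl⟩
      exact (a (U h)).2
    · exact IsClosed.preimage hc (StarSubalgebra.isClosed_topologicalClosure _)
  exact h x.2

/-- The Bogoliubov transform `γ_U`. -/
def bogoliubovHom (U : H ≃ₗᵢ[ℂ] H) : CAR H →⋆ₐ[ℂ] CAR H :=
  ((bogoliubovProd U).comp (carSubalgebra H).subtype).codRestrict _ (bogoliubovProd_mem U)

theorem bogoliubovHom_a (U : H ≃ₗᵢ[ℂ] H) (h : H) : bogoliubovHom U (a h) = a (U h) := rfl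

theorem bogoliubovHom_comp (U W : H ≃ₗᵢ[ℂ] H) (x : CAR H) :
    bogoliubovHom U (bogoliubovHom W x) = bogoliubovHom (W.trans U) x := rfl

/-- Multiplication by a complex number of modulus one. -/
def phase (z : Circle) : H ≃ₗᵢ[ℂ] H where
  toLinearEquiv := LinearEquiv.smulOfNeZero ℂ H (z : ℂ) z.coe_ne_zero
  norm_map' x := by
    change ‖(z : ℂ) • x‖ = ‖x‖
    rw [norm_smul, Circle.norm_coe, one_mul]

variable (H)

/-- The GICAR algebra: the fixed points of the gauge action. -/
def gicar : StarSubalgebra ℂ (CAR H) where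
  carrier := {x | ∀ z : Circle, bogoliubovHom (phase z) x = x}
  mul_mem' hx hy z := by rw [map_mul, hx z, hy z]
  add_mem' hx hy z := by rw [map_add, hx z, hy z]
  algebraMap_mem' r z := AlgHomClass.commutes (bogoliubovHom (phase z)) r
  star_mem' hx z := by rw [map_star, hx z]

variable {H}

theorem mem_gicar {x : CAR H} :
    x ∈ gicar H ↔ ∀ z : Circle, bogoliubovHom (phase z) x = x := Iff.rfl

/-- The Bogoliubov transform `γ_U` on the GICAR algebra. -/
def bogoliubov (U : H ≃ₗᵢ[ℂ] H) : gicar H →⋆ₐ[ℂ] gicar H :=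
  ((bogoliubovHom U).comp (gicar H).subtype).codRestrict _ fun x z => by
    have h : (phase z).trans U = U.trans (phase z) := by
      ext y
      exact (map_smul U (z : ℂ) y).symm ▸ rfl
    change bogoliubovHom (phase z) (bogoliubovHom U x) = bogoliubovHom U x
    rw [bogoliubovHom_comp, ← h, ← bogoliubovHom_comp, x.2 z]

/-- `a*(h_1) ⋯ a*(h_n) a(k_1) ⋯ a(k_m)` -/
def monomial {n m : ℕ} (h : Fin n → H) (k : Fin m → H) : CAR H :=
  (List.ofFn fun i => star (a (h i))).prod * (List.ofFn fun i => a (k i)).prod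

theorem bogoliubovHom_monomial (U : H ≃ₗᵢ[ℂ] H) {n m : ℕ} (h : Fin n → H) (k : Fin m → H) :
    bogoliubovHom U (monomial h k) = monomial (U ∘ h) (U ∘ k) := by
  simp only [monomial, map_mul, map_list_prod, List.map_ofFn, Function.comp_def, map_star,
    bogoliubovHom_a]

theorem prod_ofFn_smul {A : Type*} [Ring A] [Algebra ℂ A] (c : ℂ) {n : ℕ} (f : Fin n → A) :
    (List.ofFn fun i => c • f i).prod = c ^ n • (List.ofFn f).prod := by
  induction n with
  | zero => simp
  | succ n ih =>
    rw [List.ofFn_succ, List.ofFn_succ, List.prod_cons, List.prod_cons, ih, smul_mul_smul_comm,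
      pow_succ']

theorem monomial_mem_gicar {n : ℕ} (h k : Fin n → H) : monomial h k ∈ gicar H := by
  intro z
  rw [bogoliubovHom_monomial]
  have e : ∀ f : Fin n → H, (phase z : H ≃ₗᵢ[ℂ] H) ∘ f = fun i => (z : ℂ) • f i := fun _ => rfl
  simp only [monomial, e, a_smul, star_smul, star_star, prod_ofFn_smul, smul_mul_smul_comm]
  rw [← mul_pow]
  simp [Complex.mul_conj]

/-- The gauge-invariant monomial `a*(h_1) ⋯ a*(h_n) a(k_1) ⋯ a(k_n)`. -/
def gicarMonomial {n : ℕ} (h k : Fin n → H) : gicar H := ⟨monomial h k, monomial_mem_gicar h k⟩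

/-! ### Quasi-free states and GNS triples -/

/-- A state: a normalised positive linear functional. -/
structure IsState {A : Type*} [Ring A] [StarRing A] [Algebra ℂ A] (φ : A →ₗ[ℂ] ℂ) : Prop where
  map_one : φ 1 = 1
  nonneg : ∀ x, 0 ≤ φ (star x * x)

/-- `φ` is the quasi-free state with symbol `K`. -/
structure IsQuasiFree (K : H →L[ℂ] H) (φ : CAR H →ₗ[ℂ] ℂ) : Prop where
  isState : IsState φ
  eq_det : ∀ (n : ℕ) (h k : Fin n → H),
    φ (monomial (h ∘ Fin.rev) k) = Matrix.det (Matrix.of fun i j => (inner ℂ (k j) (K (h i)) : ℂ))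
  eq_zero : ∀ (n m : ℕ) (h : Fin n → H) (k : Fin m → H), n ≠ m → φ (monomial h k) = 0

end CAR

/-! ### The anti-symmetric Fock space in the occupation number basis -/

section Fock

/-- The anti-symmetric Fock space over a Hilbert space with a Hilbert basis indexed by `ι`. -/
abbrev Fock (ι : Type u) : Type u := lp (fun _ : Finset ι => ℂ) 2

/-- The weighted permutation operator `(W f) s = w s * f (e s)`. -/
def weightedPerm {S : Type u} (w : S → ℂ) (hw : ∀ s, ‖w s‖ ≤ 1) (e : S ≃ S) :
    lp (fun _ : S => ℂ) 2 →L[ℂ] lp (fun _ : S => ℂ) 2 :=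
  have hs : ∀ f : lp (fun _ : S => ℂ) 2, Summable fun s => ‖f (e s)‖ ^ 2 := fun f => by
    have h := (lp.memℓp f).summable (by norm_num)
    have h' : Summable fun s => ‖f s‖ ^ 2 := by simpa using h
    exact (e.summable_iff (f := fun s => ‖f s‖ ^ 2)).2 h'
  have hle : ∀ (f : lp (fun _ : S => ℂ) 2) s, ‖w s * f (e s)‖ ^ 2 ≤ ‖f (e s)‖ ^ 2 := fun f s => by
    rw [norm_mul, mul_pow]
    exact mul_le_of_le_one_left (by positivity) (pow_le_one₀ (norm_nonneg _) (hw s))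
  LinearMap.mkContinuous
    { toFun := fun f => ⟨fun s => w s * f (e s), memℓp_gen (by
        simpa using Summable.of_nonneg_of_le (fun s => by positivity) (hle f) (hs f))⟩
      map_add' := fun f g => by
        ext s
        exact mul_add _ _ _
      map_smul' := fun c f => by
        ext s
        exact mul_left_comm _ _ _ } 1 fun f => by
    rw [one_mul]
    refine lp.norm_le_of_tsum_le (by norm_num) (norm_nonneg f) ?_
    have h2 := lp.norm_rpow_eq_tsum (p := 2) (by norm_num) f
    simp only [ENNReal.toReal_ofNat, Real.rpow_ofNat] at h2 ⊢
    rw [h2, ← e.tsum_eq fun s => ‖f s‖ ^ 2]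
    exact Summable.tsum_le_tsum (hle f)
      (Summable.of_nonneg_of_le (fun s => by positivity) (hle f) (hs f)) (hs f)

theorem weightedPerm_apply {S : Type u} (w : S → ℂ) (hw : ∀ s, ‖w s‖ ≤ 1) (e : S ≃ S)
    (f : lp (fun _ : S => ℂ) 2) (s : S) : weightedPerm w hw e f s = w s * f (e s) := rfl

variable {ι : Type u} [LinearOrder ι]

/-- The sign picked up by exchanging the modes `i` and `j`. -/
def tau (i j : ι) : ℂ := if j < i then -1 else 1

/-- The sign of the mode `i` in the configuration `s`. -/
def sgn (i : ι) (s : Finset ι) : ℂ := ∏ j ∈ s, tau i j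

/-- Flipping the occupation of the mode `i`. -/
def modeFlip (i : ι) : Finset ι ≃ Finset ι where
  toFun s := symmDiff s {i}
  invFun s := symmDiff s {i}
  left_inv s := by simp
  right_inv s := by simp

theorem mem_modeFlip {i j : ι} {s : Finset ι} : j ∈ modeFlip i s ↔ ((j ∈ s ∧ j ≠ i) ∨ (j ∉ s ∧ j = i)) := by
  change j ∈ symmDiff s {i} ↔ _
  rw [Finset.mem_symmDiff, Finset.mem_singleton]
  tauto

theorem modeFlip_modeFlip (i : ι) (s : Finset ι) : modeFlip i (modeFlip i s) = s := (modeFlip i).left_inv s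

theorem modeFlip_comm (i j : ι) (s : Finset ι) : modeFlip i (modeFlip j s) = modeFlip j (modeFlip i s) := by
  change symmDiff (symmDiff s {j}) {i} = symmDiff (symmDiff s {i}) {j}
  exact symmDiff_right_comm _ _ _

theorem tau_self (i : ι) : tau i i = 1 := by simp [tau]

theorem tau_mul_self (i j : ι) : tau i j * tau i j = 1 := by
  unfold tau; split_ifs <;> norm_num

theorem tau_add {i j : ι} (h : i ≠ j) : tau i j + tau j i = 0 := by
  rcases lt_or_gt_of_ne h with h | h <;> simp [tau, h, not_lt_of_gt h]

theorem sgn_flip (i j : ι) (s : Finset ι) : sgn i (modeFlip j s) = tau i j * sgn i s := by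
  by_cases hj : j ∈ s
  · have e : modeFlip j s = s.erase j := by
      ext k
      rw [mem_modeFlip, Finset.mem_erase]
      constructor
      · rintro (h | ⟨h, rfl⟩)
        · exact h.symm
        · exact absurd hj h
      · exact fun h => Or.inl h.symm
    rw [e, sgn, sgn, ← Finset.mul_prod_erase s _ hj, ← mul_assoc, tau_mul_self, one_mul]
  · have e : modeFlip j s = insert j s := by
      ext k
      rw [mem_modeFlip, Finset.mem_insert]
      constructor
      · rintro (h | h)
        · exact Or.inr h.1
        · exact Or.inl h.2
      · rintro (rfl | h)
        · exact Or.inr ⟨hj, rfl⟩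
        · exact Or.inl ⟨h, fun e => hj (e ▸ h)⟩
    rw [e, sgn, sgn, Finset.prod_insert hj]

theorem sgn_mul_self (i : ι) (s : Finset ι) : sgn i s * sgn i s = 1 := by
  rw [sgn, ← Finset.prod_mul_distrib]
  exact Finset.prod_eq_one fun j _ => tau_mul_self i j

theorem star_sgn (i : ι) (s : Finset ι) : star (sgn i s) = sgn i s := by
  rw [sgn, star_prod]
  refine Finset.prod_congr rfl fun j _ => ?_
  unfold tau; split_ifs <;> simp

theorem norm_sgn (i : ι) (s : Finset ι) : ‖sgn i s‖ = 1 := by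
  rw [sgn, norm_prod]
  refine Finset.prod_eq_one fun j _ => ?_
  unfold tau; split_ifs <;> simp

/-- Weight of the creation operator. -/
def wCre (i : ι) (s : Finset ι) : ℂ := if i ∈ s then sgn i s else 0

/-- Weight of the annihilation operator. -/
def wAnn (i : ι) (s : Finset ι) : ℂ := if i ∈ s then 0 else sgn i s

theorem norm_wCre (i : ι) (s : Finset ι) : ‖wCre i s‖ ≤ 1 := by
  unfold wCre; split_ifs <;> simp [norm_sgn]

theorem norm_wAnn (i : ι) (s : Finset ι) : ‖wAnn i s‖ ≤ 1 := by
  unfold wAnn; split_ifs <;> simp [norm_sgn]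

theorem wAnn_flip (i : ι) (s : Finset ι) : wAnn i (modeFlip i s) = wCre i s := by
  by_cases h : i ∈ s <;> simp [wAnn, wCre, mem_modeFlip, h, sgn_flip, tau_self]

theorem wCre_flip (i : ι) (s : Finset ι) : wCre i (modeFlip i s) = wAnn i s := by
  by_cases h : i ∈ s <;> simp [wAnn, wCre, mem_modeFlip, h, sgn_flip, tau_self]

theorem wCre_flip_ne {i j : ι} (h : i ≠ j) (s : Finset ι) :
    wCre i (modeFlip j s) = tau i j * wCre i s := by
  by_cases hi : i ∈ s <;> simp [wCre, mem_modeFlip, hi, h, sgn_flip]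

theorem wAnn_flip_ne {i j : ι} (h : i ≠ j) (s : Finset ι) :
    wAnn i (modeFlip j s) = tau i j * wAnn i s := by
  by_cases hi : i ∈ s <;> simp [wAnn, mem_modeFlip, hi, h, sgn_flip]

theorem star_wAnn (i : ι) (s : Finset ι) : star (wAnn i s) = wAnn i s := by
  unfold wAnn; split_ifs <;> simp [star_sgn, -RCLike.star_def]

/-- Creation operator of the mode `i`. -/
def modeCre (i : ι) : Fock ι →L[ℂ] Fock ι := weightedPerm (wCre i) (norm_wCre i) (modeFlip i)

/-- Annihilation operator of the mode `i`. -/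
def modeAnn (i : ι) : Fock ι →L[ℂ] Fock ι := weightedPerm (wAnn i) (norm_wAnn i) (modeFlip i)

theorem modeCre_apply (i : ι) (f : Fock ι) (s : Finset ι) : modeCre i f s = wCre i s * f (modeFlip i s) := rfl

theorem modeAnn_apply (i : ι) (f : Fock ι) (s : Finset ι) : modeAnn i f s = wAnn i s * f (modeFlip i s) := rfl

theorem star_modeCre (i : ι) : star (modeCre i) = modeAnn i := by
  rw [ContinuousLinearMap.star_eq_adjoint]
  symm
  rw [ContinuousLinearMap.eq_adjoint_iff]
  intro f g
  rw [lp.inner_eq_tsum, lp.inner_eq_tsum, ← (modeFlip i).tsum_eq]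
  refine tsum_congr fun s => ?_
  rw [modeAnn_apply, modeCre_apply, modeFlip_modeFlip, wAnn_flip]
  have h : star (wCre i s) = wCre i s := by rw [← wAnn_flip, star_wAnn]
  simp only [RCLike.inner_apply, map_mul]
  rw [RCLike.star_def] at h
  rw [h]
  ring

theorem modeCre_mul_modeCre (i j : ι) : modeCre i * modeCre j + modeCre j * modeCre i = 0 := by
  ext f s
  change wCre i s * (wCre j (modeFlip i s) * f (modeFlip j (modeFlip i s)))
    + wCre j s * (wCre i (modeFlip j s) * f (modeFlip i (modeFlip j s))) = 0
  by_cases h : i = j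
  · subst h
    rw [wCre_flip]
    by_cases hi : i ∈ s <;> simp [wAnn, wCre, hi]
  · rw [wCre_flip_ne h, wCre_flip_ne (Ne.symm h), modeFlip_comm]
    linear_combination wCre i s * wCre j s * f (modeFlip i (modeFlip j s)) * tau_add h

theorem modeAnn_mul_modeCre (i j : ι) :
    modeAnn i * modeCre j + modeCre j * modeAnn i = (if i = j then (1 : ℂ) else 0) • (1 : Fock ι →L[ℂ] Fock ι) := by
  ext f s
  change wAnn i s * (wCre j (modeFlip i s) * f (modeFlip j (modeFlip i s)))
    + wCre j s * (wAnn i (modeFlip j s) * f (modeFlip i (modeFlip j s))) = (if i = j then (1 : ℂ) else 0) * f s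
  by_cases h : i = j
  · subst h
    rw [wCre_flip, wAnn_flip, modeFlip_modeFlip, if_pos rfl, one_mul]
    by_cases hi : i ∈ s <;> simp [wAnn, wCre, hi, ← mul_assoc, sgn_mul_self]
  · rw [wAnn_flip_ne h, wCre_flip_ne (Ne.symm h), modeFlip_comm, if_neg h, zero_mul]
    linear_combination wAnn i s * wCre j s * f (modeFlip i (modeFlip j s)) * tau_add h

/-- The vacuum vector. -/
def vacuum (ι : Type u) [LinearOrder ι] : Fock ι := lp.single 2 (∅ : Finset ι) (1 : ℂ)

theorem norm_vacuum : ‖vacuum ι‖ = 1 := by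
  rw [vacuum, lp.norm_single (by norm_num)]
  simp

theorem modeAnn_vacuum (i : ι) : modeAnn i (vacuum ι) = 0 := by
  ext s
  change wAnn i s * (vacuum ι) (modeFlip i s) = 0
  by_cases hi : i ∈ s
  · simp [wAnn, hi]
  · have h : modeFlip i s ≠ ∅ := by
      intro h
      have : i ∈ modeFlip i s := mem_modeFlip.2 (Or.inr ⟨hi, rfl⟩)
      simp [h] at this
    rw [vacuum, lp.single_apply_ne _ _ _ h, mul_zero]

/-- The Fock representation: creation operators over a Hilbert space `E`, together with a vacuum
vector. -/
theorem exists_fock (E : Type u) [NormedAddCommGroup E] [InnerProductSpace ℂ E] [CompleteSpace E] :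
    ∃ (F : Type u) (_ : NormedAddCommGroup F) (_ : InnerProductSpace ℂ F) (_ : CompleteSpace F)
      (c : E →L[ℂ] (F →L[ℂ] F)) (Ω : F), ‖Ω‖ = 1 ∧ (∀ g, star (c g) Ω = 0) ∧
      (∀ f g, c f * c g + c g * c f = 0) ∧
      ∀ f g, star (c f) * c g + c g * star (c f) = (inner ℂ f g : ℂ) • (1 : F →L[ℂ] F) := by
  obtain ⟨ι, b, -⟩ := exists_hilbertBasis ℂ E
  classical
  let _ : LinearOrder ι := linearOrderOfSTO WellOrderingRel
  let c₀ : (ι →₀ ℂ) →ₗ[ℂ] (Fock ι →L[ℂ] Fock ι) := Finsupp.linearCombination ℂ modeCre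
  let e₀ : (ι →₀ ℂ) →ₗ[ℂ] E := Finsupp.linearCombination ℂ b
  have hc1 : ∀ i x, c₀ (Finsupp.single i x) = x • modeCre i := fun i x => by simp [c₀]
  have he1 : ∀ i x, e₀ (Finsupp.single i x) = x • b i := fun i x => by simp [e₀]
  have h1 : ∀ v w, c₀ v * c₀ w + c₀ w * c₀ v = 0 := by
    intro v w
    induction v using Finsupp.induction_linear with
    | zero => simp
    | add v v' hv hv' =>
      rw [map_add, add_mul, mul_add, add_add_add_comm, hv, hv', add_zero]
    | single i x =>
      induction w using Finsupp.induction_linear with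
      | zero => simp
      | add w w' hw hw' =>
        rw [map_add, add_mul, mul_add, add_add_add_comm, hw, hw', add_zero]
      | single j y =>
        rw [hc1, hc1, smul_mul_smul_comm, smul_mul_smul_comm, mul_comm y x, ← smul_add,
          modeCre_mul_modeCre, smul_zero]
  have h2 : ∀ v w, star (c₀ v) * c₀ w + c₀ w * star (c₀ v)
      = (inner ℂ (e₀ v) (e₀ w) : ℂ) • (1 : Fock ι →L[ℂ] Fock ι) := by
    intro v w
    induction v using Finsupp.induction_linear with
    | zero => simp
    | add v v' hv hv' =>
      rw [map_add, map_add, star_add, add_mul, mul_add, add_add_add_comm, hv, hv', inner_add_left,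
        add_smul]
    | single i x =>
      induction w using Finsupp.induction_linear with
      | zero => simp
      | add w w' hw hw' =>
        rw [map_add, map_add, add_mul, mul_add, add_add_add_comm, hw, hw', inner_add_right,
          add_smul]
      | single j y =>
        rw [hc1, hc1, he1, he1, star_smul, star_modeCre, smul_mul_smul_comm, smul_mul_smul_comm,
          mul_comm y, ← smul_add, modeAnn_mul_modeCre, inner_smul_left, inner_smul_right,
          orthonormal_iff_ite.1 b.orthonormal i j, smul_smul]
        congr 1
        rw [RCLike.star_def, mul_assoc]
        congr
  have hn : ∀ v, ‖c₀ v‖ ≤ 1 * ‖e₀ v‖ := by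
    intro v
    have : Nontrivial (Fock ι) := ⟨vacuum ι, 0, fun h => by
      have := norm_vacuum (ι := ι)
      rw [h, norm_zero] at this
      exact zero_ne_one this⟩
    rw [one_mul]
    refine norm_le_of_anticomm (norm_nonneg _) ?_
    rw [h2, inner_self_eq_norm_sq_to_K]
    rfl
  have hd : DenseRange e₀ := by
    have h := b.dense_span
    rw [← Submodule.dense_iff_topologicalClosure_eq_top] at h
    have hr : Set.range e₀ = (Submodule.span ℂ (Set.range b) : Set E) := by
      rw [← Finsupp.range_linearCombination]
      rfl
    rw [DenseRange, hr]
    exact h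
  let c : E →L[ℂ] (Fock ι →L[ℂ] Fock ι) := c₀.extendOfNorm e₀
  have hc : ∀ v, c (e₀ v) = c₀ v := fun v => LinearMap.extendOfNorm_eq hd ⟨1, hn⟩ v
  refine ⟨Fock ι, inferInstance, inferInstance, inferInstance, c, vacuum ι, norm_vacuum,
    ?_, ?_, ?_⟩
  · intro g
    refine hd.induction_on (p := fun g => star (c g) (vacuum ι) = 0) g
      (isClosed_eq (by fun_prop) (by fun_prop)) fun v => ?_
    rw [hc]
    induction v using Finsupp.induction_linear with
    | zero => simp
    | add v v' hv hv' => rw [map_add, star_add, add_apply, hv, hv', add_zero]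
    | single i x => rw [hc1, star_smul, star_modeCre, smul_apply, modeAnn_vacuum,
        smul_zero]
  · intro f g
    refine hd.induction_on₂ (p := fun f g => c f * c g + c g * c f = 0)
      (isClosed_eq (by fun_prop) (by fun_prop)) (fun v w => ?_) f g
    rw [hc, hc, h1]
  · intro f g
    refine hd.induction_on₂ (p := fun f g => star (c f) * c g + c g * star (c f)
      = (inner ℂ f g : ℂ) • (1 : Fock ι →L[ℂ] Fock ι))
      (isClosed_eq (by fun_prop) (by fun_prop)) (fun v w => ?_) f g
    rw [hc, hc, h2]

section Wick

variable {E F : Type*} [NormedAddCommGroup E] [InnerProductSpace ℂ E]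
  [NormedAddCommGroup F] [InnerProductSpace ℂ F] [CompleteSpace F]
  {c : E →L[ℂ] (F →L[ℂ] F)} {Ω : F}

/-- An annihilation operator applied to `c(f_1) ⋯ c(f_n) Ω`. -/
theorem ann_prod_vacuum (h0 : ∀ g, star (c g) Ω = 0)
    (h2 : ∀ f g, star (c f) * c g + c g * star (c f) = (inner ℂ f g : ℂ) • (1 : F →L[ℂ] F))
    (g : E) : ∀ {n : ℕ} (f : Fin (n + 1) → E),
      star (c g) ((List.ofFn fun i => c (f i)).prod Ω) = ∑ j : Fin (n + 1),
        ((-1) ^ (j : ℕ) * (inner ℂ g (f j) : ℂ)) •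
          (List.ofFn fun i => c (f (j.succAbove i))).prod Ω := by
  have key : ∀ (f : E) (x : F), star (c g) (c f x) = (inner ℂ g f : ℂ) • x - c f (star (c g) x) :=
    fun f x => eq_sub_of_add_eq (by
      simpa using congrArg (fun T : F →L[ℂ] F => T x) (h2 g f))
  intro n
  induction n with
  | zero =>
    intro f
    simp [key, h0]
  | succ n ih =>
    intro f
    rw [List.ofFn_succ, List.prod_cons, mul_apply_eq_comp, key,
      ih (fun i => f i.succ), map_sum, Fin.sum_univ_succ (n := n + 1), sub_eq_add_neg,
      ← Finset.sum_neg_distrib]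
    congr 1
    · simp
    · refine Finset.sum_congr rfl fun j _ => ?_
      rw [List.ofFn_succ (f := fun i => c (f (j.succ.succAbove i))), List.prod_cons,
        mul_apply_eq_comp, map_smul, ← neg_smul]
      simp [pow_succ]

theorem inner_prod_prod (hΩ : ‖Ω‖ = 1) (h0 : ∀ g, star (c g) Ω = 0)
    (h2 : ∀ f g, star (c f) * c g + c g * star (c f) = (inner ℂ f g : ℂ) • (1 : F →L[ℂ] F)) :
    ∀ {n : ℕ} (g f : Fin n → E),
      inner ℂ ((List.ofFn fun i => c (g i)).prod Ω) ((List.ofFn fun i => c (f i)).prod Ω)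
        = Matrix.det (Matrix.of fun i j => (inner ℂ (g i) (f j) : ℂ)) := by
  intro n
  induction n with
  | zero =>
    intro g f
    simp [hΩ]
  | succ n ih =>
    intro g f
    rw [List.ofFn_succ (f := fun i => c (g i)), List.prod_cons, mul_apply_eq_comp,
      ← ContinuousLinearMap.adjoint_inner_right, ← ContinuousLinearMap.star_eq_adjoint,
      ann_prod_vacuum h0 h2, inner_sum, Matrix.det_succ_row_zero]
    refine Finset.sum_congr rfl fun j _ => ?_
    rw [inner_smul_right, ih]
    rfl

theorem inner_prod_prod_ne (h0 : ∀ g, star (c g) Ω = 0)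
    (h2 : ∀ f g, star (c f) * c g + c g * star (c f) = (inner ℂ f g : ℂ) • (1 : F →L[ℂ] F)) :
    ∀ {n m : ℕ} (g : Fin n → E) (f : Fin m → E), n ≠ m →
      (inner ℂ ((List.ofFn fun i => c (g i)).prod Ω) ((List.ofFn fun i => c (f i)).prod Ω) : ℂ)
        = 0 := by
  have aux : ∀ {m : ℕ} (f : Fin (m + 1) → E),
      (inner ℂ ((List.ofFn fun i => c (f i)).prod Ω) Ω : ℂ) = 0 := by
    intro m f
    rw [List.ofFn_succ, List.prod_cons, mul_apply_eq_comp,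
      ← ContinuousLinearMap.adjoint_inner_right, ← ContinuousLinearMap.star_eq_adjoint, h0,
      inner_zero_right]
  intro n
  induction n with
  | zero =>
    intro m g f h
    obtain ⟨m, rfl⟩ := Nat.exists_eq_succ_of_ne_zero (Ne.symm h)
    rw [← inner_conj_symm, show (List.ofFn fun i => c (g i)).prod Ω = Ω by simp, aux f, map_zero]
  | succ n ih =>
    intro m g f h
    cases m with
    | zero => simpa using aux g
    | succ m =>
      rw [List.ofFn_succ (f := fun i => c (g i)), List.prod_cons, mul_apply_eq_comp,
        ← ContinuousLinearMap.adjoint_inner_right, ← ContinuousLinearMap.star_eq_adjoint,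
        ann_prod_vacuum h0 h2, inner_sum]
      refine Finset.sum_eq_zero fun j _ => ?_
      rw [inner_smul_right, ih _ _ (by omega), mul_zero]

end Wick

end Fock
section Existence

variable {H : Type u} [NormedAddCommGroup H] [InnerProductSpace ℂ H] [CompleteSpace H]

theorem star_ofFn_prod {A : Type*} [Ring A] [StarRing A] :
    ∀ {n : ℕ} (f : Fin n → A),
      star (List.ofFn f).prod = (List.ofFn fun i => star (f (Fin.rev i))).prod := by
  intro n
  induction n with
  | zero =>
    intro f
    simp
  | succ n ih =>
    intro f
    rw [List.ofFn_succ, List.prod_cons, star_mul, ih, List.ofFn_succ', List.concat_eq_append,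
      List.prod_append]
    simp [Fin.rev_castSucc]

/-- Every positive contraction is the symbol of a quasi-free state: with `K = T* T` and
`1 - K = S* S`, it is the vacuum state of the representation
`a(h) ↦ a(S h ⊕ 0) + a*(0 ⊕ conj (T h))` on the Fock space over `H` plus its conjugate; the
conjugate of `H` is realised by conjugating coordinates in a Hilbert basis. -/
theorem exists_isQuasiFree (K : H →L[ℂ] H) (hK₀ : 0 ≤ K) (hK₁ : K ≤ 1) :
    ∃ φ : CAR H →ₗ[ℂ] ℂ, IsQuasiFree K φ := by
  obtain ⟨T, hT⟩ := CStarAlgebra.nonneg_iff_eq_star_mul_self.1 hK₀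
  obtain ⟨S, hS⟩ := CStarAlgebra.nonneg_iff_eq_star_mul_self.1 (sub_nonneg.2 hK₁)
  have hT' : ∀ h k, (inner ℂ (T k) (T h) : ℂ) = inner ℂ k (K h) := fun h k => by
    rw [hT, mul_apply_eq_comp, ContinuousLinearMap.star_eq_adjoint,
      ContinuousLinearMap.adjoint_inner_right]
  have hS' : ∀ h k, (inner ℂ (S k) (S h) : ℂ) = inner ℂ k h - inner ℂ k (K h) := fun h k => by
    have e : h - K h = star S (S h) := congrArg (fun R : H →L[ℂ] H => R h) hS
    rw [← inner_sub_right, e, ContinuousLinearMap.star_eq_adjoint,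
      ContinuousLinearMap.adjoint_inner_right]
  obtain ⟨ι, b, -⟩ := exists_hilbertBasis ℂ H
  let J : H → lp (fun _ : ι => ℂ) 2 := fun h => star (b.repr h)
  have hJ : ∀ h k, (inner ℂ (J h) (J k) : ℂ) = inner ℂ k h := fun h k => by
    rw [← b.repr.inner_map_map k h, lp.inner_eq_tsum, lp.inner_eq_tsum]
    refine tsum_congr fun i => ?_
    simp [J, mul_comm]
  have hJ_add : ∀ h k, J (h + k) = J h + J k := fun h k => by simp [J]
  have hJ_smul : ∀ (z : ℂ) h, J (z • h) = star z • J h := fun z h => by simp [J]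
  obtain ⟨F, _, _, _, c, Ω, hΩ, h0, h1, h2⟩ := exists_fock (WithLp 2 (H × lp (fun _ : ι => ℂ) 2))
  let p : H → WithLp 2 (H × lp (fun _ : ι => ℂ) 2) := fun h => WithLp.toLp 2 (S h, 0)
  let q : H → WithLp 2 (H × lp (fun _ : ι => ℂ) 2) := fun h =>
    WithLp.toLp 2 (0, J (T h))
  have hpq : ∀ h k, (inner ℂ (p h) (q k) : ℂ) = 0 := fun h k => by
    simp [p, q, WithLp.prod_inner_apply]
  have hqp : ∀ h k, (inner ℂ (q h) (p k) : ℂ) = 0 := fun h k => by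
    simp [p, q, WithLp.prod_inner_apply]
  have hpp : ∀ h k, (inner ℂ (p h) (p k) : ℂ) = inner ℂ (S h) (S k) := fun h k => by
    simp [p, WithLp.prod_inner_apply]
  have hqq : ∀ h k, (inner ℂ (q h) (q k) : ℂ) = inner ℂ (T k) (T h) := fun h k => by
    simp [q, WithLp.prod_inner_apply, hJ]
  have hp_add : ∀ h k, p (h + k) = p h + p k := fun h k => by
    simp [p, ← WithLp.toLp_add]
  have hq_add : ∀ h k, q (h + k) = q h + q k := fun h k => by
    simp [q, ← WithLp.toLp_add, hJ_add]
  have hp_smul : ∀ (z : ℂ) h, p (z • h) = z • p h := fun z h => by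
    simp [p, ← WithLp.toLp_smul]
  have hq_smul : ∀ (z : ℂ) h, q (z • h) = star z • q h := fun z h => by
    simp [q, ← WithLp.toLp_smul, hJ_smul]
  have hnt : Nontrivial F := ⟨Ω, 0, fun h => by
    rw [h, norm_zero] at hΩ
    exact zero_ne_one hΩ⟩
  let π : CARRep H :=
    { carrier := F →L[ℂ] F
      ann :=
        { toFun := fun h => star (c (p h)) + c (q h)
          map_add' := fun h k => by
            rw [hp_add, hq_add, map_add, map_add, star_add]
            abel
          map_smul' := fun z h => by
            rw [hp_smul, hq_smul, map_smul, map_smul, star_smul, smul_add]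
            rfl }
      ann_mul_ann := fun h k => by
        change (star (c (p h)) + c (q h)) * (star (c (p k)) + c (q k))
          + (star (c (p k)) + c (q k)) * (star (c (p h)) + c (q h)) = 0
        have e1 : star (c (p h)) * star (c (p k)) + star (c (p k)) * star (c (p h)) = 0 := by
          rw [← star_mul, ← star_mul, ← star_add, h1, star_zero]
        have e2 := h1 (q h) (q k)
        have e3 := h2 (p h) (q k)
        have e4 := h2 (p k) (q h)
        rw [hpq, zero_smul] at e3 e4
        have e5 : ∀ x y z w : F →L[ℂ] F, x * z + z * x = 0 → y * w + w * y = 0 →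
            x * w + w * x = 0 → z * y + y * z = 0 →
            (x + y) * (z + w) + (z + w) * (x + y) = 0 := by
          intro x y z w i1 i2 i3 i4
          have : (x + y) * (z + w) + (z + w) * (x + y) = (x * z + z * x) + (y * w + w * y)
            + (x * w + w * x) + (z * y + y * z) := by
            simp only [mul_add, add_mul]
            abel
          rw [this, i1, i2, i3, i4, add_zero, add_zero, add_zero]
        exact e5 _ _ _ _ e1 e2 e3 e4
      star_ann_mul_ann := fun h k => by
        change star (star (c (p h)) + c (q h)) * (star (c (p k)) + c (q k))
          + (star (c (p k)) + c (q k)) * star (star (c (p h)) + c (q h)) = _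
        rw [star_add, star_star]
        have e1 := h2 (p k) (p h)
        have e2 := h2 (q h) (q k)
        have e3 := h1 (p h) (q k)
        have e4 : star (c (q h)) * star (c (p k)) + star (c (p k)) * star (c (q h)) = 0 := by
          rw [← star_mul, ← star_mul, ← star_add, h1, star_zero]
        have e5 : (inner ℂ k h : ℂ) • (1 : F →L[ℂ] F)
            = (inner ℂ (p k) (p h) : ℂ) • (1 : F →L[ℂ] F)
              + (inner ℂ (q h) (q k) : ℂ) • (1 : F →L[ℂ] F) := by
          rw [← add_smul, hpp, hqq, hS', hT', sub_add_cancel]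
        rw [e5, ← e1, ← e2]
        have e6 : ∀ x y z w : F →L[ℂ] F, x * w + w * x = 0 → z * y + y * z = 0 →
            (x + z) * (y + w) + (y + w) * (x + z) = y * x + x * y + (z * w + w * z) := by
          intro x y z w hx hz
          have : (x + z) * (y + w) + (y + w) * (x + z) = (y * x + x * y + (z * w + w * z))
            + (x * w + w * x) + (z * y + y * z) := by
            simp only [mul_add, add_mul]
            abel
          rw [this, hx, hz, add_zero, add_zero]
        exact e6 _ _ _ _ e3 e4 }
  have hπ : ∀ h, π.ann h = star (c (p h)) + c (q h) := fun h => rfl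
  have hvec : ∀ {n : ℕ} (k : Fin n → H), (List.ofFn fun i => π.ann (k i)).prod Ω
      = (List.ofFn fun i => c (q (k i))).prod Ω := by
    intro n
    induction n with
    | zero =>
      intro k
      simp
    | succ n ih =>
      intro k
      rw [List.ofFn_succ, List.prod_cons, List.ofFn_succ, List.prod_cons]
      change π.ann (k 0) ((List.ofFn fun i => π.ann (k i.succ)).prod Ω) = _
      rw [ih, hπ, add_apply, mul_apply_eq_comp, add_eq_right]
      cases n with
      | zero => simp [h0]
      | succ n =>
        rw [ann_prod_vacuum h0 h2]
        exact Finset.sum_eq_zero fun j _ => by rw [hpq, mul_zero, zero_smul]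
  let ψ : (F →L[ℂ] F) →ₗ[ℂ] ℂ :=
    { toFun := fun R => inner ℂ Ω (R Ω)
      map_add' := fun R R' => by rw [add_apply, inner_add_right]
      map_smul' := fun z R => by rw [smul_apply, inner_smul_right]; rfl }
  let φ : CAR H →ₗ[ℂ] ℂ := ψ.comp (CAR.lift π).toAlgHom.toLinearMap
  have hφ : ∀ {n m : ℕ} (h : Fin n → H) (k : Fin m → H), φ (monomial h k)
      = inner ℂ ((List.ofFn fun i => c (q (h (Fin.rev i)))).prod Ω)
        ((List.ofFn fun i => c (q (k i))).prod Ω) := by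
    intro n m h k
    change inner ℂ Ω ((CAR.lift π (monomial h k)) Ω) = _
    have e : CAR.lift π (monomial h k) = star (List.ofFn fun i => π.ann (h (Fin.rev i))).prod
        * (List.ofFn fun i => π.ann (k i)).prod := by
      rw [monomial, map_mul, map_list_prod, map_list_prod, List.map_ofFn, List.map_ofFn,
        star_ofFn_prod]
      simp only [Function.comp_def, map_star, Fin.rev_rev]
      rfl
    rw [e]
    change inner ℂ Ω ((star (List.ofFn fun i => π.ann (h (Fin.rev i))).prod : F →L[ℂ] F)
      ((List.ofFn fun i => π.ann (k i)).prod Ω)) = _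
    rw [ContinuousLinearMap.star_eq_adjoint, ContinuousLinearMap.adjoint_inner_right, hvec, hvec]
  refine ⟨φ, ⟨?_, ?_⟩, ?_, ?_⟩
  · change inner ℂ Ω ((CAR.lift π 1) Ω) = (1 : ℂ)
    rw [map_one]
    change inner ℂ Ω Ω = (1 : ℂ)
    rw [inner_self_eq_norm_sq_to_K, hΩ]
    simp
  · intro x
    change 0 ≤ (inner ℂ Ω ((CAR.lift π (star x * x)) Ω) : ℂ)
    rw [map_mul, map_star]
    change 0 ≤ (inner ℂ Ω ((star (CAR.lift π x) : F →L[ℂ] F) ((CAR.lift π x : F →L[ℂ] F) Ω)) : ℂ)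
    rw [ContinuousLinearMap.star_eq_adjoint, ContinuousLinearMap.adjoint_inner_right]
    rw [inner_self_eq_norm_sq_to_K]
    have hnn := Complex.zero_le_real.2 (sq_nonneg ‖(CAR.lift π x : F →L[ℂ] F) Ω‖)
    rw [Complex.ofReal_pow] at hnn
    exact hnn
  · intro n h k
    rw [hφ]
    simp only [Function.comp_apply, Fin.rev_rev]
    rw [inner_prod_prod hΩ h0 h2]
    simp only [hqq, hT']
  · intro n m h k hnm
    rw [hφ, inner_prod_prod_ne h0 h2 _ _ hnm]

/-- The quasi-free state with symbol `K`; a state is continuous, hence determined by its values on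
the monomials, so the choice is immaterial. -/
def quasiFreeState (K : H →L[ℂ] H) (hK₀ : 0 ≤ K) (hK₁ : K ≤ 1) : CAR H →ₗ[ℂ] ℂ :=
  (exists_isQuasiFree K hK₀ hK₁).choose

theorem quasiFreeState_spec (K : H →L[ℂ] H) (hK₀ : 0 ≤ K) (hK₁ : K ≤ 1) :
    IsQuasiFree K (quasiFreeState K hK₀ hK₁) :=
  (exists_isQuasiFree K hK₀ hK₁).choose_spec

/-- The restriction of the quasi-free state with symbol `K` to the GICAR algebra. -/
def gicarState (K : H →L[ℂ] H) (hK₀ : 0 ≤ K) (hK₁ : K ≤ 1) : gicar H →ₗ[ℂ] ℂ :=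
  (quasiFreeState K hK₀ hK₁).comp (gicar H).subtype.toAlgHom.toLinearMap

end Existence

/-- `(ρ, E, Ω)` is a GNS triple of the functional `φ`. -/
structure IsGNSTriple {A : Type*} [Ring A] [StarRing A] [Algebra ℂ A] (φ : A →ₗ[ℂ] ℂ)
    {E : Type*} [NormedAddCommGroup E] [InnerProductSpace ℂ E] [CompleteSpace E]
    (ρ : A →⋆ₐ[ℂ] (E →L[ℂ] E)) (Ω : E) : Prop where
  cyclic : Dense (Set.range fun x => ρ x Ω)
  inner_eq : ∀ x, inner ℂ Ω (ρ x Ω) = φ x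

/-- The (unbounded) operator `A` commutes with the bounded operator `K`: `K A ⊆ A K`. -/
def Commutes {H : Type*} [NormedAddCommGroup H] [InnerProductSpace ℂ H] (A : H →ₗ.[ℂ] H)
    (K : H →L[ℂ] H) : Prop :=
  ∀ x : A.domain, ∃ hx : K x ∈ A.domain, A ⟨K x, hx⟩ = K (A x)

section Dynamics

variable {H : Type u} [NormedAddCommGroup H] [InnerProductSpace ℂ H]
  {E : Type*} [NormedAddCommGroup E] [InnerProductSpace ℂ E] [CompleteSpace E]

/-- `Γ t (ρ(x) Ω) = ρ(γ_{U t}(x)) Ω` for all `t` and all `x` in the GICAR algebra. -/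
def Implements (Γ : UnitaryGroup E) (U : UnitaryGroup H) (ρ : gicar H →⋆ₐ[ℂ] (E →L[ℂ] E))
    (Ω : E) : Prop :=
  ∀ (t : ℝ) (x : gicar H), Γ t (ρ x Ω) = ρ (bogoliubov (U t) x) Ω

/-- The span of the vectors `ρ(a*(h_1) ⋯ a*(h_n) a(k_1) ⋯ a(k_n)) Ω` with `n ≥ 0` and all `h_i`,
`k_i` in `V`. -/
def monomialSpan (ρ : gicar H →⋆ₐ[ℂ] (E →L[ℂ] E)) (Ω : E) (V : Submodule ℂ H) : Submodule ℂ E :=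
  Submodule.span ℂ {v | ∃ (n : ℕ) (h k : Fin n → H),
    (∀ i, h i ∈ V) ∧ (∀ i, k i ∈ V) ∧ v = ρ (gicarMonomial h k) Ω}

end Dynamics

end GICAR

end

/-!
Since `U t` commutes with `K`, the determinant formula for `φ_K` shows that `φ_K` and
`φ_K ∘ γ_{U t}` agree on normally ordered monomials, which span a dense subspace of the CAR algebra.
So `ρ(x) Ω ↦ ρ(γ_{U t}(x)) Ω` is isometric and extends to the GNS space.

Averaging over the `N`-th roots of unity in the gauge group kills the monomials whose numbers of
creation and annihilation operators differ, once `N` is large, and fixes the others. Hence the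
gauge-invariant monomials span a dense subspace of the GICAR algebra, and the monomial vectors with
entries in `V` span a dense subspace of the GNS space. It is invariant under the implementing group
and lies in the domain of its generator `B`.

Such a subspace `D` is a core: if `z` is orthogonal to `(B + i) D`, then for `x ∈ D` the function
`t ↦ ⟪z, Γ t x⟫` is a bounded solution of `f' = f`, so it vanishes. Thus `(B + i) D` is dense, and
since `‖(B + i) x‖² = ‖B x‖² + ‖x‖²`, the graph of `B` on `D` is dense in the graph of `B`.
-/

noncomputable section

universe u

namespace GICAR

/-! ### Symmetric operators and cores -/

section Core

variable {E : Type*} [NormedAddCommGroup E] [InnerProductSpace ℂ E]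

variable (E) in
/-- The map `(x, y) ↦ y + i x`, which carries the graph of an operator `T` onto the range of
`T + i`. -/
def graphShift : E × E →ₗ[ℂ] E :=
  LinearMap.snd ℂ E E + Complex.I • LinearMap.fst ℂ E E

@[simp]
theorem graphShift_apply (p : E × E) : graphShift E p = p.2 + Complex.I • p.1 := rfl

theorem norm_graphShift_sq {T : E →ₗ.[ℂ] E} (hT : T.IsFormalAdjoint T) {p : E × E}
    (hp : p ∈ T.graph) : ‖graphShift E p‖ ^ 2 = ‖p.2‖ ^ 2 + ‖p.1‖ ^ 2 := by
  obtain ⟨x, rfl⟩ := T.mem_graph_iff'.1 hp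
  have him : (inner ℂ (T x) (x : E)).im = 0 :=
    Complex.conj_eq_iff_im.1 <| by rw [inner_conj_symm, hT]
  rw [graphShift_apply, norm_add_sq (𝕜 := ℂ), inner_smul_right, norm_smul, Complex.norm_I]
  simp [him]

theorem norm_le_norm_graphShift {T : E →ₗ.[ℂ] E} (hT : T.IsFormalAdjoint T) {p : E × E}
    (hp : p ∈ T.graph) : ‖p‖ ≤ ‖graphShift E p‖ := by
  have h := norm_graphShift_sq hT hp
  exact norm_prod_le_iff.2
    ⟨le_of_sq_le_sq (h ▸ le_add_of_nonneg_left (sq_nonneg _)) (norm_nonneg _),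
      le_of_sq_le_sq (h ▸ le_add_of_nonneg_right (sq_nonneg _)) (norm_nonneg _)⟩

theorem hasCore_of_dense_map_graphShift {T : E →ₗ.[ℂ] E} (hT : T.IsFormalAdjoint T)
    (hcl : T.IsClosed) {D : Submodule ℂ E} (hD : D ≤ T.domain)
    (hdense : Dense ((T.domRestrict D).graph.map (graphShift E) : Set E)) : T.HasCore D := by
  have hle : T.domRestrict D ≤ T := LinearPMap.domRestrict_le
  have hcb : (T.domRestrict D).IsClosable := hcl.isClosable.leIsClosable hle
  have hgraph := LinearPMap.le_graph_of_le hle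
  refine ⟨hD, LinearPMap.eq_of_eq_graph (le_antisymm ?_ fun p hp => ?_)⟩ <;>
    rw [← hcb.graph_closure_eq_closure_graph]
  · exact Submodule.topologicalClosure_minimal _ hgraph hcl
  · refine Metric.mem_closure_iff.2 fun ε hε => ?_
    obtain ⟨_, ⟨q, hq, rfl⟩, hpq⟩ := Metric.mem_closure_iff.1 (hdense (graphShift E p)) ε hε
    refine ⟨q, hq, lt_of_le_of_lt ?_ hpq⟩
    rw [dist_eq_norm, dist_eq_norm, ← map_sub]
    exact norm_le_norm_graphShift hT (sub_mem hp (hgraph hq))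

end Core

/-! ### Generators of unitary groups -/

theorem eq_zero_of_hasDerivAt_self {F : Type*} [NormedAddCommGroup F] [NormedSpace ℝ F]
    {f : ℝ → F} {C : ℝ} (hf : ∀ t, HasDerivAt f (f t) t) (hC : ∀ t, ‖f t‖ ≤ C) : f = 0 := by
  have hconst (s t : ℝ) : Real.exp (-s) • f s = Real.exp (-t) • f t := by
    have hg (t : ℝ) : HasDerivAt (fun s : ℝ => Real.exp (-s) • f s) 0 t := by
      refine ((hasDerivAt_neg t).exp.smul (hf t)).congr_deriv ?_
      module
    exact is_const_of_deriv_eq_zero (f := fun s : ℝ => Real.exp (-s) • f s)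
      (fun t => (hg t).differentiableAt) (fun t => (hg t).deriv) s t
  have hlim : Filter.Tendsto (fun t : ℝ => Real.exp (-t) • f t) Filter.atTop (nhds 0) :=
    Real.tendsto_exp_neg_atTop_nhds_zero.zero_smul_isBoundedUnder_le
      (Filter.isBoundedUnder_of ⟨C, hC⟩)
  funext s
  have hs : Real.exp (-s) • f s = 0 :=
    tendsto_nhds_unique (tendsto_const_nhds.congr fun t => hconst s t) hlim
  exact (smul_eq_zero.1 hs).resolve_left (Real.exp_ne_zero _)

namespace UnitaryGroup

variable {E : Type*} [NormedAddCommGroup E] [InnerProductSpace ℂ E] (U : UnitaryGroup E)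

theorem mem_graph_generator_iff {x y : E} :
    (x, y) ∈ U.generator.graph ↔ HasDerivAt (fun t : ℝ => U t x) (Complex.I • y) 0 := by
  have hI (d : E) : -Complex.I • d = y ↔ d = Complex.I • y := by
    rw [← Complex.inv_I, inv_smul_eq_iff₀ Complex.I_ne_zero]
  rw [LinearPMap.mem_graph_iff]
  constructor
  · rintro ⟨⟨_, hx⟩, rfl, hy⟩
    rw [← (hI _).1 hy]
    exact hx.hasDerivAt
  · intro h
    exact ⟨⟨x, h.differentiableAt⟩, rfl, (hI _).2 h.deriv⟩

variable {U} {x y : E}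

theorem hasDerivAt_apply (h : (x, y) ∈ U.generator.graph) (t : ℝ) :
    HasDerivAt (fun s : ℝ => U s x) (Complex.I • U t y) t := by
  have hshift : HasDerivAt (fun s : ℝ => U (s - t) x) (Complex.I • y) t := by
    refine HasDerivAt.comp_sub_const (f := fun s : ℝ => U s x) t t ?_
    rwa [sub_self, ← mem_graph_generator_iff]
  have hU := ((U t).toContinuousLinearEquiv.toContinuousLinearMap.restrictScalars
    ℝ).hasFDerivAt.comp_hasDerivAt t hshift
  simpa [Function.comp_def, ← U.map_add'] using hU

theorem apply_mem_graph_generator (h : (x, y) ∈ U.generator.graph) (t : ℝ) :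
    (U t x, U t y) ∈ U.generator.graph := by
  have hd := hasDerivAt_apply h t
  rw [← zero_add t] at hd
  simpa only [mem_graph_generator_iff, U.map_add', U.map_zero', zero_add]
    using hd.comp_add_const 0 t

theorem isFormalAdjoint_generator : U.generator.IsFormalAdjoint U.generator := by
  intro x y
  have hx := U.mem_graph_generator_iff.1 (LinearPMap.mem_graph _ x)
  have hy := U.mem_graph_generator_iff.1 (LinearPMap.mem_graph _ y)
  have hd := hx.inner ℂ hy
  simp only [LinearIsometryEquiv.inner_map_map, U.map_zero', inner_smul_left, inner_smul_right,
    Complex.conj_I] at hd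
  refine mul_left_cancel₀ Complex.I_ne_zero ?_
  linear_combination -hd.unique (hasDerivAt_const _ _)

theorem inner_eq_inner_of_mem_graph {x' y' : E} (h : (x, y) ∈ U.generator.graph)
    (h' : (x', y') ∈ U.generator.graph) : (inner ℂ y x' : ℂ) = inner ℂ x y' := by
  obtain ⟨v, rfl, rfl⟩ := (LinearPMap.mem_graph_iff _).1 h
  obtain ⟨w, rfl, rfl⟩ := (LinearPMap.mem_graph_iff _).1 h'
  exact isFormalAdjoint_generator v w

theorem isClosed_generator : U.generator.IsClosed := by
  refine isClosed_of_closure_subset fun p hp => ?_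
  obtain ⟨u, hu, hlim⟩ := mem_closure_iff_seq_limit.1 hp
  have huniform : TendstoUniformly (fun n (t : ℝ) => Complex.I • U t (u n).2)
      (fun t => Complex.I • U t p.2) Filter.atTop := by
    refine Metric.tendstoUniformly_iff.2 fun ε hε => ?_
    filter_upwards [Metric.tendsto_nhds.1 hlim.snd_nhds ε hε] with n hn t
    rwa [dist_smul₀, Complex.norm_I, one_mul, LinearIsometryEquiv.dist_map, dist_comm]
  have hd := hasDerivAt_of_tendstoUniformly huniform
    (Filter.Eventually.of_forall fun n t => hasDerivAt_apply (hu n) t)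
    (fun t => ((U t).continuous.tendsto _).comp hlim.fst_nhds) 0
  rw [U.map_zero'] at hd
  exact U.mem_graph_generator_iff.2 hd

theorem hasCore_generator [CompleteSpace E] {D : Submodule ℂ E} (hD : Dense (D : Set E))
    (hdom : D ≤ U.generator.domain) (hinv : ∀ t : ℝ, ∀ x ∈ D, U t x ∈ D) :
    U.generator.HasCore D := by
  refine hasCore_of_dense_map_graphShift isFormalAdjoint_generator isClosed_generator hdom ?_
  rw [Submodule.dense_iff_topologicalClosure_eq_top, Submodule.topologicalClosure_eq_top_iff,
    Submodule.eq_bot_iff]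
  intro z hz
  refine hD.eq_zero_of_inner_left (𝕜 := ℂ) fun x hx => ?_
  obtain ⟨y, hxy⟩ := LinearPMap.mem_domain_iff.1 (hdom hx)
  have horth (t : ℝ) : inner ℂ z (Complex.I • U t y) = inner ℂ z (U t x) := by
    have hmem : (U t x, U t y) ∈ (U.generator.domRestrict D).graph := by
      obtain ⟨w, hw, hw'⟩ := (LinearPMap.mem_graph_iff _).1 (apply_mem_graph_generator hxy t)
      exact (LinearPMap.mem_graph_iff _).2 ⟨⟨w, hw ▸ hinv t x hx, w.2⟩, hw, hw'⟩
    have h := (Submodule.mem_orthogonal' _ _).1 hz _ (Submodule.mem_map_of_mem hmem)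
    rw [graphShift_apply, inner_add_right, inner_smul_right] at h
    rw [inner_smul_right]
    linear_combination Complex.I * h - inner ℂ z (U t x) * Complex.I_mul_I
  have hzero : (fun t => inner ℂ z (U t x)) = 0 :=
    eq_zero_of_hasDerivAt_self (C := ‖z‖ * ‖x‖)
      (fun t => by simpa [horth] using (hasDerivAt_const t z).inner ℂ (hasDerivAt_apply hxy t))
      fun t => by simpa using norm_inner_le_norm (𝕜 := ℂ) z (U t x)
  simpa only [U.map_zero', Pi.zero_apply] using congrFun hzero 0

theorem eq_apply_of_hasDerivAt {u v : ℝ → E} (hu : ∀ t, HasDerivAt u (Complex.I • v t) t)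
    (hmem : ∀ t, (u t, v t) ∈ U.generator.graph) (t : ℝ) : u t = U t (u 0) := by
  have hnorm (s : ℝ) : HasDerivAt (fun r => inner ℂ (u r - U r (u 0)) (u r - U r (u 0))) 0 s := by
    have hd := (hu s).fun_sub (hasDerivAt_apply (hmem 0) s)
    have hgraph : (u s - U s (u 0), v s - U s (v 0)) ∈ U.generator.graph :=
      sub_mem (hmem s) (apply_mem_graph_generator (hmem 0) s)
    have hsymm := inner_eq_inner_of_mem_graph hgraph hgraph
    refine (hd.inner ℂ hd).congr_deriv ?_
    rw [← smul_sub, inner_smul_left, inner_smul_right, hsymm, Complex.conj_I]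
    ring
  have hconst := is_const_of_deriv_eq_zero (fun s => (hnorm s).differentiableAt)
    (fun s => (hnorm s).deriv) t 0
  rw [U.map_zero', sub_self, inner_zero_left] at hconst
  exact sub_eq_zero.1 (inner_self_eq_zero.1 hconst)

end UnitaryGroup

namespace Commutes

variable {E : Type*} [NormedAddCommGroup E] [InnerProductSpace ℂ E] {K : E →L[ℂ] E}

theorem map_mem_graph {T : E →ₗ.[ℂ] E} (hK : Commutes T K) {x y : E} (h : (x, y) ∈ T.graph) :
    (K x, K y) ∈ T.graph := by
  obtain ⟨v, rfl, rfl⟩ := (LinearPMap.mem_graph_iff _).1 h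
  obtain ⟨hv, hTv⟩ := hK v
  exact (LinearPMap.mem_graph_iff _).2 ⟨⟨K v, hv⟩, rfl, hTv⟩

theorem map_apply {U : UnitaryGroup E} (hK : Commutes U.generator K)
    (hdense : Dense (U.generator.domain : Set E)) (t : ℝ) (x : E) : K (U t x) = U t (K x) := by
  have hcl : IsClosed {x | K (U t x) = U t (K x)} := isClosed_eq (by fun_prop) (by fun_prop)
  refine hcl.closure_subset_iff.2 (fun x hx => ?_) (hdense x)
  obtain ⟨y, hxy⟩ := LinearPMap.mem_domain_iff.1 hx
  have hsol := UnitaryGroup.eq_apply_of_hasDerivAt (u := fun s => K (U s x))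
    (v := fun s => K (U s y)) (fun s => ?_)
    (fun s => hK.map_mem_graph (UnitaryGroup.apply_mem_graph_generator hxy s)) t
  · simpa only [U.map_zero', Set.mem_ofPred_eq] using hsol
  · simpa [Function.comp_def] using (K.restrictScalars ℝ).hasFDerivAt.comp_hasDerivAt s
      (UnitaryGroup.hasDerivAt_apply hxy s)

end Commutes

/-! ### Differentiability of monomials -/

theorem differentiableAt_of_isometry_comp {F G : Type*} [NormedAddCommGroup F]
    [NormedSpace ℝ F] [NormedAddCommGroup G] [NormedSpace ℝ G] [CompleteSpace G] (e : G →ₗ[ℝ] F)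
    (he : Isometry e) {f : ℝ → G} {t : ℝ} (hf : DifferentiableAt ℝ (e ∘ f) t) :
    DifferentiableAt ℝ f t := by
  have hslope := hf.hasDerivAt.tendsto_slope
  rw [show slope (e ∘ f) t = e ∘ slope f t from funext (e.slope_comp f t)] at hslope
  obtain ⟨d, hd⟩ : deriv (e ∘ f) t ∈ Set.range e :=
    he.isClosedEmbedding.isClosed_range.mem_of_tendsto hslope
      (Filter.Eventually.of_forall fun s => ⟨_, rfl⟩)
  rw [← hd] at hslope
  exact (hasDerivAt_iff_tendsto_slope.2
    (he.isEmbedding.isInducing.tendsto_nhds_iff.2 hslope)).differentiableAt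

theorem differentiableAt_starSubalgebra_of_coe {A : Type*} [CStarAlgebra A]
    {S : StarSubalgebra ℂ A} (hS : IsClosed (S : Set A)) {f : ℝ → S} {t : ℝ}
    (hf : DifferentiableAt ℝ (fun s => (f s : A)) t) : DifferentiableAt ℝ f t :=
  have : CompleteSpace S := hS.completeSpace_coe
  differentiableAt_of_isometry_comp (S.subtype.toAlgHom.toLinearMap.restrictScalars ℝ)
    isometry_subtype_coe hf

theorem continuous_prod_ofFn {X M : Type*} [TopologicalSpace X] [TopologicalSpace M] [Monoid M]
    [ContinuousMul M] {n : ℕ} {f : Fin n → X → M} (hf : ∀ i, Continuous (f i)) :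
    Continuous fun x => (List.ofFn fun i => f i x).prod := by
  simp only [List.ofFn_eq_map]
  exact continuous_list_prod _ fun i _ => hf i

theorem differentiableAt_prod_ofFn {𝕜 X M : Type*} [NontriviallyNormedField 𝕜]
    [NormedAddCommGroup X] [NormedSpace 𝕜 X] [NormedRing M] [NormedAlgebra 𝕜 M] {x : X} {n : ℕ}
    {f : Fin n → X → M} (hf : ∀ i, DifferentiableAt 𝕜 (f i) x) :
    DifferentiableAt 𝕜 (fun y => (List.ofFn fun i => f i y).prod) x := by
  simp only [List.ofFn_eq_map]
  exact (HasFDerivAt.list_prod' fun i _ => (hf i).hasFDerivAt).differentiableAt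

section CAR

variable {H : Type u} [NormedAddCommGroup H] [InnerProductSpace ℂ H]

theorem norm_a_le (h : H) : ‖a h‖ ≤ ‖h‖ :=
  lp.norm_le_of_forall_le (norm_nonneg h) fun π => π.norm_ann_le h

variable (H) in
/-- The annihilation operators `h ↦ a(h)` as a continuous map. It is conjugate linear over `ℂ`;
only real linearity is recorded, which is what differentiation along real curves uses. -/
def annCLM : H →L[ℝ] CAR H :=
  LinearMap.mkContinuous
    { toFun := a
      map_add' := fun h k => by
        ext π
        exact π.ann.map_add h k
      map_smul' := fun c h => (a_smul (c : ℂ) h).trans (by simp) }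
    1 fun h => (norm_a_le h).trans_eq (one_mul _).symm

theorem continuous_monomial {n m : ℕ} :
    Continuous fun p : (Fin n → H) × (Fin m → H) => monomial p.1 p.2 :=
  (continuous_prod_ofFn fun i =>
    ((annCLM H).continuous.comp ((continuous_apply i).comp continuous_fst)).star).mul
  (continuous_prod_ofFn fun i =>
    (annCLM H).continuous.comp ((continuous_apply i).comp continuous_snd))

theorem continuous_gicarMonomial {n : ℕ} :
    Continuous fun p : (Fin n → H) × (Fin n → H) => gicarMonomial p.1 p.2 :=
  continuous_monomial.subtype_mk _

theorem differentiableAt_monomial {t : ℝ} {n m : ℕ} {h : Fin n → ℝ → H} {k : Fin m → ℝ → H}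
    (hh : ∀ i, DifferentiableAt ℝ (h i) t) (hk : ∀ i, DifferentiableAt ℝ (k i) t) :
    DifferentiableAt ℝ (fun s => monomial (fun i => h i s) (fun i => k i s)) t :=
  (differentiableAt_prod_ofFn fun i => ((annCLM H).differentiableAt.comp t (hh i)).star).mul
    (differentiableAt_prod_ofFn fun i => (annCLM H).differentiableAt.comp t (hk i))

open scoped CStarAlgebra in
theorem continuous_bogoliubovHom (U : H ≃ₗᵢ[ℂ] H) : Continuous (bogoliubovHom U) :=
  map_continuous (bogoliubovHom U)

theorem isClosed_gicar : IsClosed (gicar H : Set (CAR H)) := by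
  have hset : (gicar H : Set (CAR H)) = ⋂ z : Circle, {x | bogoliubovHom (phase z) x = x} := by
    ext x
    simp [mem_gicar]
  rw [hset]
  exact isClosed_iInter fun z => isClosed_eq (continuous_bogoliubovHom _) continuous_id

theorem differentiableAt_gicarMonomial {t : ℝ} {n : ℕ} {h k : Fin n → ℝ → H}
    (hh : ∀ i, DifferentiableAt ℝ (h i) t) (hk : ∀ i, DifferentiableAt ℝ (k i) t) :
    DifferentiableAt ℝ (fun s => gicarMonomial (fun i => h i s) (fun i => k i s)) t :=
  differentiableAt_starSubalgebra_of_coe isClosed_gicar (differentiableAt_monomial hh hk)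

/-! ### Normal ordering -/

variable (H) in
/-- The normally ordered polynomials in the creation and annihilation operators. -/
def normalOrderedSpan : Submodule ℂ (CAR H) :=
  Submodule.span ℂ {x | ∃ (n m : ℕ) (h : Fin n → H) (k : Fin m → H), x = monomial h k}

theorem monomial_mem_normalOrderedSpan {n m : ℕ} (h : Fin n → H) (k : Fin m → H) :
    monomial h k ∈ normalOrderedSpan H :=
  Submodule.subset_span ⟨n, m, h, k, rfl⟩

theorem mul_mem_normalOrderedSpan {x y : CAR H}
    (hx : ∀ {n m : ℕ} (h : Fin n → H) (k : Fin m → H), x * monomial h k ∈ normalOrderedSpan H)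
    (hy : y ∈ normalOrderedSpan H) : x * y ∈ normalOrderedSpan H := by
  have hle : normalOrderedSpan H ≤ (normalOrderedSpan H).comap (LinearMap.mulLeft ℂ x) := by
    refine Submodule.span_le.2 ?_
    rintro _ ⟨n, m, h, k, rfl⟩
    exact hx h k
  exact hle hy

theorem star_a_mul_monomial (f : H) {n m : ℕ} (h : Fin n → H) (k : Fin m → H) :
    star (a f) * monomial h k = monomial (Fin.cons f h) k := by
  simp [monomial, List.ofFn_succ, mul_assoc]

theorem star_a_mul_mem_normalOrderedSpan (f : H) {x : CAR H} (hx : x ∈ normalOrderedSpan H) :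
    star (a f) * x ∈ normalOrderedSpan H :=
  mul_mem_normalOrderedSpan
    (fun h k => star_a_mul_monomial f h k ▸ monomial_mem_normalOrderedSpan _ _) hx

theorem a_mul_monomial_mem_normalOrderedSpan (f : H) {n m : ℕ} (h : Fin n → H) (k : Fin m → H) :
    a f * monomial h k ∈ normalOrderedSpan H := by
  induction n with
  | zero =>
    have hcons : a f * monomial h k = monomial h (Fin.cons f k : Fin (m + 1) → H) := by
      simp [monomial, List.ofFn_succ]
    exact hcons ▸ monomial_mem_normalOrderedSpan _ _
  | succ n ih =>
    have hcomm : a f * star (a (h 0))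
        = (inner ℂ f (h 0) : ℂ) • (1 : CAR H) - star (a (h 0)) * a f :=
      eq_sub_of_add_eq' (star_a_mul_a (h 0) f)
    rw [← Fin.cons_self_tail h, ← star_a_mul_monomial, ← mul_assoc, hcomm, sub_mul,
      smul_mul_assoc, one_mul, mul_assoc]
    exact sub_mem (Submodule.smul_mem _ _ (monomial_mem_normalOrderedSpan _ _))
      (star_a_mul_mem_normalOrderedSpan _ (ih _))

theorem mul_mem_normalOrderedSpan_of_mem_adjoin {x y : CAR H}
    (hx : x ∈ StarAlgebra.adjoin ℂ (Set.range (a : H → CAR H))) (hy : y ∈ normalOrderedSpan H) :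
    x * y ∈ normalOrderedSpan H := by
  change x ∈ Algebra.adjoin ℂ _ at hx
  induction hx using Algebra.adjoin_induction generalizing y with
  | mem x hx =>
    rcases hx with ⟨f, rfl⟩ | ⟨f, hf⟩
    · exact mul_mem_normalOrderedSpan (a_mul_monomial_mem_normalOrderedSpan f) hy
    · rw [← star_star x, ← hf]
      exact star_a_mul_mem_normalOrderedSpan f hy
  | algebraMap r => simpa only [← Algebra.smul_def] using Submodule.smul_mem _ r hy
  | add x x' _ _ hx hx' => simpa only [add_mul] using add_mem (hx hy) (hx' hy)
  | mul x x' _ _ hx hx' => simpa only [mul_assoc] using hx (hx' hy)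

theorem dense_adjoin_a :
    Dense (StarAlgebra.adjoin ℂ (Set.range (a : H → CAR H)) : Set (CAR H)) := by
  have himage : Subtype.val '' (StarAlgebra.adjoin ℂ (Set.range (a : H → CAR H)) : Set (CAR H))
      = (StarAlgebra.adjoin ℂ (Set.range (annProd (H := H))) : Set (CARProduct H)) := by
    have hmap := StarAlgHom.map_adjoin (carSubalgebra H).subtype (Set.range (a : H → CAR H))
    rw [← Set.range_comp] at hmap
    exact congrArg SetLike.coe hmap
  intro x
  rw [closure_subtype, himage]
  exact x.2

theorem dense_normalOrderedSpan : Dense (normalOrderedSpan H : Set (CAR H)) := by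
  have hone : (1 : CAR H) ∈ normalOrderedSpan H := by
    simpa [monomial] using monomial_mem_normalOrderedSpan (Fin.elim0 : Fin 0 → H) Fin.elim0
  exact dense_adjoin_a.mono fun x hx => by
    simpa using mul_mem_normalOrderedSpan_of_mem_adjoin hx hone

end CAR

/-! ### Gauge averages -/

section PowAverage

variable {F : Type*} [AddCommGroup F] [Module ℂ F]

/-- The Cesàro mean of the first `N` powers of a linear map. -/
def powAverage (T : Module.End ℂ F) (N : ℕ) :
    Module.End ℂ F :=
  (N : ℂ)⁻¹ • ∑ j ∈ Finset.range N, T ^ j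

theorem powAverage_apply (T : Module.End ℂ F) (N : ℕ) (x : F) :
    powAverage T N x = (N : ℂ)⁻¹ • ∑ j ∈ Finset.range N, (T ^ j) x := by
  simp [powAverage]

theorem powAverage_of_apply_eq_smul {T : Module.End ℂ F} {w : ℂ} {x : F} (hx : T x = w • x)
    (N : ℕ) :
    powAverage T N x = ((N : ℂ)⁻¹ * ∑ j ∈ Finset.range N, w ^ j) • x := by
  have hpow (j : ℕ) : (T ^ j) x = w ^ j • x := by
    induction j with
    | zero => simp
    | succ j ih => rw [pow_succ, Module.End.mul_apply, hx, map_smul, ih, smul_smul, pow_succ']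
  rw [powAverage_apply, Finset.sum_congr rfl fun j _ => hpow j, ← Finset.sum_smul, smul_smul]

theorem powAverage_of_apply_eq_self {T : Module.End ℂ F} {N : ℕ} (hN : N ≠ 0) {x : F}
    (hx : T x = x) : powAverage T N x = x := by
  rw [powAverage_of_apply_eq_smul (w := 1) (hx.trans (one_smul ℂ x).symm)]
  simp [hN]

theorem powAverage_eq_zero {T : Module.End ℂ F} {N : ℕ} {w : ℂ} (hw : w ≠ 1) (hwN : w ^ N = 1)
    {x : F} (hx : T x = w • x) : powAverage T N x = 0 := by
  rw [powAverage_of_apply_eq_smul hx, geom_sum_eq hw, hwN, sub_self, zero_div, mul_zero, zero_smul]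

end PowAverage

theorem norm_powAverage_le {F : Type*} [NormedAddCommGroup F] [NormedSpace ℂ F]
    {T : Module.End ℂ F} (hT : ∀ x, ‖T x‖ ≤ ‖x‖) (N : ℕ) (x : F) : ‖powAverage T N x‖ ≤ ‖x‖ := by
  have hpow (j : ℕ) : ‖(T ^ j) x‖ ≤ ‖x‖ := by
    induction j with
    | zero => simp
    | succ j ih =>
      rw [pow_succ', Module.End.mul_apply]
      exact (hT _).trans ih
  rw [powAverage_apply, norm_smul, norm_inv, Complex.norm_natCast]
  refine inv_mul_le_of_le_mul₀ (Nat.cast_nonneg N) (norm_nonneg x) ?_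
  simpa using norm_sum_le_of_le (Finset.range N) fun j _ => hpow j

theorem exists_circle_isPrimitiveRoot {N : ℕ} (hN : N ≠ 0) : ∃ z : Circle, IsPrimitiveRoot z N := by
  have h := Complex.isPrimitiveRoot_exp N hN
  exact ⟨⟨_, mem_sphere_zero_iff_norm.2 (h.norm'_eq_one hN)⟩,
    .of_map_of_injective (f := Circle.coeHom) h Circle.coe_injective⟩

section CAR

variable {H : Type u} [NormedAddCommGroup H] [InnerProductSpace ℂ H]

variable (H) in
/-- The gauge automorphism `a(h) ↦ a(zh)` as a linear map. -/
def gaugeEnd (z : Circle) : Module.End ℂ (CAR H) :=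
  (bogoliubovHom (phase z)).toAlgHom.toLinearMap

theorem gaugeEnd_monomial (z : Circle) {n m : ℕ} (h : Fin n → H) (k : Fin m → H) :
    gaugeEnd H z (monomial h k) = ((z ^ n / z ^ m : Circle) : ℂ) • monomial h k := by
  have hphase {l : ℕ} (f : Fin l → H) : (phase z : H ≃ₗᵢ[ℂ] H) ∘ f = fun i => (z : ℂ) • f i := rfl
  refine (bogoliubovHom_monomial (phase z) h k).trans ?_
  simp only [monomial, hphase, a_smul, star_smul, star_star, prod_ofFn_smul, smul_mul_smul_comm]
  simp [div_eq_mul_inv, ← Circle.coe_inv_eq_conj]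

theorem powAverage_gaugeEnd_of_mem_gicar (z : Circle) {N : ℕ} (hN : N ≠ 0) {x : CAR H}
    (hx : x ∈ gicar H) : powAverage (gaugeEnd H z) N x = x :=
  powAverage_of_apply_eq_self hN (mem_gicar.1 hx z)

theorem powAverage_gaugeEnd_monomial_of_ne {z : Circle} {N : ℕ} (hz : IsPrimitiveRoot z N)
    {n m : ℕ} (hn : n < N) (hm : m < N) (hnm : n ≠ m) (h : Fin n → H) (k : Fin m → H) :
    powAverage (gaugeEnd H z) N (monomial h k) = 0 := by
  refine powAverage_eq_zero (fun hw => hnm (hz.pow_inj hn hm ?_)) ?_ (gaugeEnd_monomial z h k)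
  · exact div_eq_one.1 (Circle.coe_eq_one.1 hw)
  · rw [← Circle.coe_pow, div_pow, pow_right_comm, pow_right_comm z m, hz.pow_eq_one]
    simp

variable (H) in
/-- The span of the monomials with as many creation as annihilation operators. -/
def gicarMonomialSpan : Submodule ℂ (gicar H) :=
  Submodule.span ℂ {x | ∃ (n : ℕ) (h k : Fin n → H), x = gicarMonomial h k}

theorem eventually_powAverage_gaugeEnd_mem {x : CAR H} (hx : x ∈ normalOrderedSpan H) :
    ∀ᶠ N : ℕ in Filter.atTop, ∀ z : Circle, IsPrimitiveRoot z N →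
      ∃ y ∈ gicarMonomialSpan H, (y : CAR H) = powAverage (gaugeEnd H z) N x := by
  induction hx using Submodule.span_induction with
  | mem x hx =>
    obtain ⟨n, m, h, k, rfl⟩ := hx
    filter_upwards [Filter.eventually_gt_atTop n, Filter.eventually_gt_atTop m] with N hn hm z hz
    rcases eq_or_ne n m with rfl | hnm
    · exact ⟨gicarMonomial h k, Submodule.subset_span ⟨n, h, k, rfl⟩,
        (powAverage_gaugeEnd_of_mem_gicar z (Nat.ne_zero_of_lt hn) (monomial_mem_gicar h k)).symm⟩
    · exact ⟨0, zero_mem _, (powAverage_gaugeEnd_monomial_of_ne hz hn hm hnm h k).symm⟩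
  | zero => exact Filter.Eventually.of_forall fun N z _ => ⟨0, zero_mem _, (map_zero _).symm⟩
  | add x y _ _ hx hy =>
    filter_upwards [hx, hy] with N hNx hNy z hz
    obtain ⟨u, hu, hux⟩ := hNx z hz
    obtain ⟨v, hv, hvy⟩ := hNy z hz
    exact ⟨u + v, add_mem hu hv, by rw [map_add, ← hux, ← hvy]; rfl⟩
  | smul c x _ hx =>
    filter_upwards [hx] with N hN z hz
    obtain ⟨u, hu, hux⟩ := hN z hz
    exact ⟨c • u, Submodule.smul_mem _ c hu, by rw [map_smul, ← hux]; rfl⟩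

theorem dense_gicarMonomialSpan : Dense (gicarMonomialSpan H : Set (gicar H)) := by
  refine fun x => Metric.mem_closure_iff.2 fun ε hε => ?_
  obtain ⟨y, hy, hxy⟩ := Metric.mem_closure_iff.1 (dense_normalOrderedSpan (x : CAR H)) ε hε
  obtain ⟨N, hN, hN₀⟩ := ((eventually_powAverage_gaugeEnd_mem hy).and
    (Filter.eventually_ne_atTop 0)).exists
  obtain ⟨z, hz⟩ := exists_circle_isPrimitiveRoot hN₀
  obtain ⟨w, hw, hwy⟩ := hN z hz
  have hsub : (x : CAR H) - w = powAverage (gaugeEnd H z) N (x - y) := by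
    rw [map_sub, powAverage_gaugeEnd_of_mem_gicar z hN₀ x.2, hwy]
  refine ⟨w, hw, lt_of_le_of_lt ?_ hxy⟩
  rw [Subtype.dist_eq, dist_eq_norm, dist_eq_norm, hsub]
  exact norm_powAverage_le (NonUnitalStarAlgHom.norm_apply_le (bogoliubovHom (phase z))) N _

end CAR

/-! ### Invariance of quasi-free states -/

theorem IsState.continuous {A : Type*} [CStarAlgebra A] {φ : A →ₗ[ℂ] ℂ} (hφ : IsState φ) :
    Continuous φ := by
  let _ := CStarAlgebra.spectralOrder A
  let _ := CStarAlgebra.spectralOrderedRing A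
  refine map_continuous (PositiveLinearMap.mk₀ φ fun x hx => ?_)
  obtain ⟨y, rfl⟩ := CStarAlgebra.nonneg_iff_eq_star_mul_self.1 hx
  exact hφ.nonneg y

theorem continuous_apply_of_dense {X E F : Type*} [TopologicalSpace X] [PseudoMetricSpace E]
    [PseudoMetricSpace F] {G : X → E → F} (hG : ∀ t, LipschitzWith 1 (G t)) {s : Set E}
    (hs : Dense s) (hcont : ∀ w ∈ s, Continuous fun t => G t w) (v : E) :
    Continuous fun t => G t v := by
  refine continuous_of_uniform_approx_of_continuous fun u hu => ?_
  obtain ⟨ε, hε, hεu⟩ := Metric.mem_uniformity_dist.1 hu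
  obtain ⟨w, hw, hvw⟩ := Metric.mem_closure_iff.1 (hs v) ε hε
  exact ⟨fun t => G t w, hcont w hw, fun t => hεu (((hG t).dist_le_mul v w).trans_lt (by simpa))⟩

section CAR

variable {H : Type u} [NormedAddCommGroup H] [InnerProductSpace ℂ H]

theorem IsQuasiFree.apply_bogoliubovHom_monomial {K : H →L[ℂ] H} {φ : CAR H →ₗ[ℂ] ℂ}
    (hφ : IsQuasiFree K φ) {W : H ≃ₗᵢ[ℂ] H} (hW : ∀ x, K (W x) = W (K x)) {n m : ℕ}
    (h : Fin n → H) (k : Fin m → H) :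
    φ (bogoliubovHom W (monomial h k)) = φ (monomial h k) := by
  rw [bogoliubovHom_monomial]
  rcases eq_or_ne n m with rfl | hnm
  · have hdet (f g : Fin n → H) : φ (monomial f g)
        = Matrix.det (Matrix.of fun i j => (inner ℂ (g j) (K (f i.rev)) : ℂ)) := by
      simpa [Function.comp_def] using hφ.eq_det n (f ∘ Fin.rev) g
    simp only [hdet, Function.comp_apply, hW, LinearIsometryEquiv.inner_map_map]
  · rw [hφ.eq_zero n m _ _ hnm, hφ.eq_zero n m _ _ hnm]

theorem IsQuasiFree.apply_bogoliubovHom {K : H →L[ℂ] H} {φ : CAR H →ₗ[ℂ] ℂ}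
    (hφ : IsQuasiFree K φ) {W : H ≃ₗᵢ[ℂ] H} (hW : ∀ x, K (W x) = W (K x)) (x : CAR H) :
    φ (bogoliubovHom W x) = φ x := by
  have hcont := hφ.isState.continuous
  have hspan : Set.EqOn (φ ∘ bogoliubovHom W) φ (normalOrderedSpan H) := by
    refine LinearMap.eqOn_span (f := φ ∘ₗ (bogoliubovHom W).toAlgHom.toLinearMap) ?_
    rintro _ ⟨n, m, h, k, rfl⟩
    exact hφ.apply_bogoliubovHom_monomial hW h k
  exact congrFun ((hcont.comp (continuous_bogoliubovHom W)).ext_on dense_normalOrderedSpan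
    hcont hspan) x

theorem gicarState_bogoliubov [CompleteSpace H] {K : H →L[ℂ] H} (hK₀ : 0 ≤ K) (hK₁ : K ≤ 1)
    {W : H ≃ₗᵢ[ℂ] H} (hW : ∀ x, K (W x) = W (K x)) (x : gicar H) :
    gicarState K hK₀ hK₁ (bogoliubov W x) = gicarState K hK₀ hK₁ x :=
  (quasiFreeState_spec K hK₀ hK₁).apply_bogoliubovHom hW x

/-! ### Bogoliubov automorphisms -/

theorem bogoliubov_gicarMonomial (W : H ≃ₗᵢ[ℂ] H) {n : ℕ} (h k : Fin n → H) :
    bogoliubov W (gicarMonomial h k) = gicarMonomial (W ∘ h) (W ∘ k) :=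
  Subtype.ext (bogoliubovHom_monomial W h k)

theorem bogoliubov_trans (U W : H ≃ₗᵢ[ℂ] H) (x : gicar H) :
    bogoliubov (U.trans W) x = bogoliubov W (bogoliubov U x) := rfl

theorem bogoliubov_refl (x : gicar H) : bogoliubov (LinearIsometryEquiv.refl ℂ H) x = x := rfl

/-- The Bogoliubov transform `γ_U` as an automorphism of the GICAR algebra. -/
def bogoliubovEquiv (U : H ≃ₗᵢ[ℂ] H) : gicar H ≃⋆ₐ[ℂ] gicar H :=
  StarAlgEquiv.ofStarAlgHom (bogoliubov U) (bogoliubov U.symm)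
    (by ext x : 1; simp [← bogoliubov_trans, bogoliubov_refl])
    (by ext x : 1; simp [← bogoliubov_trans, bogoliubov_refl])

theorem continuous_bogoliubov_apply {X : Type*} [TopologicalSpace X] {U : X → H ≃ₗᵢ[ℂ] H}
    (hU : ∀ h, Continuous fun t => U t h) (x : gicar H) :
    Continuous fun t => bogoliubov (U t) x := by
  refine Continuous.subtype_mk (f := fun t => bogoliubovHom (U t) (x : CAR H)) ?_ _
  refine continuous_apply_of_dense (G := fun t => bogoliubovHom (U t)) (fun t => ?_)
    dense_normalOrderedSpan (fun y hy => ?_) x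
  · exact AddMonoidHomClass.lipschitz_of_bound_nnnorm _ 1 fun y =>
      (NonUnitalStarAlgHom.norm_apply_le (bogoliubovHom (U t)) y).trans_eq (one_mul _).symm
  · induction hy using Submodule.span_induction with
    | mem y hy =>
      obtain ⟨n, m, h, k, rfl⟩ := hy
      simp only [bogoliubovHom_monomial]
      exact continuous_monomial.comp
        ((continuous_pi fun i => hU (h i)).prodMk (continuous_pi fun i => hU (k i)))
    | zero => simpa only [map_zero] using continuous_const
    | add y z _ _ hy hz => simpa only [map_add] using hy.fun_add hz
    | smul c y _ hy => simpa only [map_smul] using hy.fun_const_smul c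

end CAR

/-! ### Implementation on the GNS space -/

section GNS

variable {A E : Type*} [NormedAddCommGroup E] [InnerProductSpace ℂ E] [CompleteSpace E]

/-- The orbit `x ↦ ρ(x) Ω` of a vector under a representation, as a linear map. -/
def orbitMap [Semiring A] [Algebra ℂ A] [Star A] (ρ : A →⋆ₐ[ℂ] (E →L[ℂ] E)) (Ω : E) :
    A →ₗ[ℂ] E where
  toFun x := ρ x Ω
  map_add' x y := by rw [map_add, add_apply]
  map_smul' c x := by rw [map_smul, smul_apply, RingHom.id_apply]

section CStar

variable [CStarAlgebra A] {S : StarSubalgebra ℂ A} (hS : IsClosed (S : Set A))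
  (ρ : S →⋆ₐ[ℂ] (E →L[ℂ] E)) (Ω : E)

include hS

open scoped CStarAlgebra in
theorem continuous_orbitMap : Continuous (orbitMap ρ Ω) := by
  let _ : CStarAlgebra S := StarSubalgebra.cstarAlgebra S
  exact (ContinuousLinearMap.apply ℂ E Ω).continuous.comp (map_continuous ρ)

theorem differentiableAt_orbitMap_comp {f : ℝ → S} {t : ℝ} (hf : DifferentiableAt ℝ f t) :
    DifferentiableAt ℝ (fun s => orbitMap ρ Ω (f s)) t :=
  ((ContinuousLinearMap.mk (orbitMap ρ Ω) (continuous_orbitMap hS ρ Ω)).restrictScalars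
    ℝ).differentiableAt.comp t hf

end CStar

namespace IsGNSTriple

variable [Ring A] [StarRing A] [Algebra ℂ A] {φ : A →ₗ[ℂ] ℂ} {ρ : A →⋆ₐ[ℂ] (E →L[ℂ] E)} {Ω : E}

theorem inner_apply_apply (hρ : IsGNSTriple φ ρ Ω) (x y : A) :
    inner ℂ (ρ x Ω) (ρ y Ω) = φ (star x * y) := by
  rw [← hρ.inner_eq, map_mul, map_star, ContinuousLinearMap.star_eq_adjoint, mul_apply_eq_comp,
    ContinuousLinearMap.adjoint_inner_right]

theorem exists_linearIsometryEquiv (hρ : IsGNSTriple φ ρ Ω) (γ : A ≃⋆ₐ[ℂ] A)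
    (hγ : ∀ x, φ (γ x) = φ x) : ∃ G : E ≃ₗᵢ[ℂ] E, ∀ x, G (ρ x Ω) = ρ (γ x) Ω := by
  have hdense : DenseRange (orbitMap ρ Ω) := hρ.cyclic
  have hnorm (x : A) : ‖orbitMap ρ Ω (γ x)‖ = ‖orbitMap ρ Ω x‖ := by
    change ‖ρ (γ x) Ω‖ = ‖ρ x Ω‖
    rw [norm_eq_sqrt_re_inner (𝕜 := ℂ), norm_eq_sqrt_re_inner (𝕜 := ℂ), hρ.inner_apply_apply,
      hρ.inner_apply_apply, ← map_star, ← map_mul, hγ]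
  exact ⟨γ.toAlgEquiv.toLinearEquiv.extendOfIsometry _ _ hdense hdense hnorm,
    LinearEquiv.extendOfIsometry_eq _ _ _ hdense hdense hnorm⟩

end IsGNSTriple

end GNS

section Implementation

variable {H : Type u} [NormedAddCommGroup H] [InnerProductSpace ℂ H]
  {E : Type*} [NormedAddCommGroup E] [InnerProductSpace ℂ E] [CompleteSpace E]
  {ρ : gicar H →⋆ₐ[ℂ] (E →L[ℂ] E)} {Ω : E} {U : UnitaryGroup H}

theorem IsGNSTriple.exists_implements {φ : gicar H →ₗ[ℂ] ℂ} (hρ : IsGNSTriple φ ρ Ω)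
    (hφ : ∀ t x, φ (bogoliubov (U t) x) = φ x) : ∃ Γ : UnitaryGroup E, Implements Γ U ρ Ω := by
  choose G hG using fun t => hρ.exists_linearIsometryEquiv (bogoliubovEquiv (U t)) (hφ t)
  have hdense : DenseRange fun x => ρ x Ω := hρ.cyclic
  refine ⟨⟨G, fun v => ?_, fun s t v => ?_, fun v => ?_⟩, hG⟩
  · refine congrFun (hdense.equalizer (G 0).continuous continuous_id (funext fun x => ?_)) v
    have hU : U 0 = LinearIsometryEquiv.refl ℂ H := LinearIsometryEquiv.ext U.map_zero'
    exact (hG 0 x).trans (by rw [hU]; rfl)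
  · refine congrFun (hdense.equalizer (G (s + t)).continuous
      ((G s).continuous.comp (G t).continuous) (funext fun x => ?_)) v
    have hU : U (s + t) = (U t).trans (U s) := LinearIsometryEquiv.ext (U.map_add' s t)
    simp only [Function.comp_apply, hG, hU]
    rfl
  · refine continuous_apply_of_dense (G := fun t => G t) (fun t => (G t).isometry.lipschitz)
      hρ.cyclic ?_ v
    rintro _ ⟨x, rfl⟩
    simp only [hG]
    exact (continuous_orbitMap isClosed_gicar ρ Ω).comp
      (continuous_bogoliubov_apply U.continuous' x)

theorem Implements.unique (hcyc : Dense (Set.range fun x => ρ x Ω)) {Γ Γ' : UnitaryGroup E}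
    (h : Implements Γ U ρ Ω) (h' : Implements Γ' U ρ Ω) : Γ = Γ' := by
  refine UnitaryGroup.ext (funext fun t => LinearIsometryEquiv.ext fun v => ?_)
  refine congrFun (DenseRange.equalizer hcyc (Γ t).continuous (Γ' t).continuous ?_) v
  exact funext fun x => (h t x).trans (h' t x).symm

theorem IsGNSTriple.existsUnique_implements {φ : gicar H →ₗ[ℂ] ℂ} (hρ : IsGNSTriple φ ρ Ω)
    (hφ : ∀ t x, φ (bogoliubov (U t) x) = φ x) : ∃! Γ : UnitaryGroup E, Implements Γ U ρ Ω := by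
  obtain ⟨Γ, hΓ⟩ := hρ.exists_implements hφ
  exact ⟨Γ, hΓ, fun Γ' hΓ' => hΓ'.unique hρ.cyclic hΓ⟩

theorem gicarMonomial_apply_mem_closure_monomialSpan {V : Submodule ℂ H}
    (hV : Dense (V : Set H)) {n : ℕ} (h k : Fin n → H) :
    ρ (gicarMonomial h k) Ω ∈ closure (monomialSpan ρ Ω V : Set E) := by
  have hcont : Continuous fun p : (Fin n → H) × (Fin n → H) => ρ (gicarMonomial p.1 p.2) Ω :=
    (continuous_orbitMap isClosed_gicar ρ Ω).comp continuous_gicarMonomial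
  have hVn : Dense (Set.univ.pi fun _ : Fin n => (V : Set H)) := dense_pi _ fun _ _ => hV
  refine closure_mono (Set.image_subset_iff.2 fun p hp => ?_)
    (hcont.range_subset_closure_image_dense (hVn.prod hVn) ⟨(h, k), rfl⟩)
  exact Submodule.subset_span ⟨n, p.1, p.2, fun i => hp.1 i trivial, fun i => hp.2 i trivial, rfl⟩

theorem dense_monomialSpan (hcyc : Dense (Set.range fun x => ρ x Ω)) {V : Submodule ℂ H}
    (hV : Dense (V : Set H)) : Dense (monomialSpan ρ Ω V : Set E) := by
  have hle : gicarMonomialSpan H ≤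
      (monomialSpan ρ Ω V).topologicalClosure.comap (orbitMap ρ Ω) := by
    refine Submodule.span_le.2 ?_
    rintro _ ⟨n, h, k, rfl⟩
    exact gicarMonomial_apply_mem_closure_monomialSpan hV h k
  have hrange : DenseRange (orbitMap ρ Ω) := hcyc
  exact dense_closure.1 ((hrange.dense_image (continuous_orbitMap isClosed_gicar ρ Ω)
    dense_gicarMonomialSpan).mono (Set.image_subset_iff.2 hle))

theorem Implements.map_mem_monomialSpan {Γ : UnitaryGroup E} (hΓ : Implements Γ U ρ Ω)
    {V : Submodule ℂ H} (hinv : ∀ t : ℝ, ∀ v ∈ V, U t v ∈ V) (t : ℝ) {x : E}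
    (hx : x ∈ monomialSpan ρ Ω V) : Γ t x ∈ monomialSpan ρ Ω V := by
  have hle : monomialSpan ρ Ω V ≤
      (monomialSpan ρ Ω V).comap (Γ t).toLinearEquiv.toLinearMap := by
    refine Submodule.span_le.2 ?_
    rintro _ ⟨n, h, k, hh, hk, rfl⟩
    refine Submodule.subset_span ⟨n, U t ∘ h, U t ∘ k, fun i => hinv t _ (hh i),
      fun i => hinv t _ (hk i), ?_⟩
    rw [← bogoliubov_gicarMonomial]
    exact hΓ t _
  exact hle hx

theorem Implements.monomialSpan_le_domain {Γ : UnitaryGroup E} (hΓ : Implements Γ U ρ Ω)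
    {V : Submodule ℂ H} (hV : V ≤ U.generator.domain) :
    monomialSpan ρ Ω V ≤ Γ.generator.domain := by
  refine Submodule.span_le.2 ?_
  rintro _ ⟨n, h, k, hh, hk, rfl⟩
  change DifferentiableAt ℝ (fun t : ℝ => Γ t (ρ (gicarMonomial h k) Ω)) 0
  simp only [hΓ _ _, bogoliubov_gicarMonomial]
  exact differentiableAt_orbitMap_comp isClosed_gicar ρ Ω (differentiableAt_gicarMonomial
    (h := fun i s => U s (h i)) (k := fun i s => U s (k i)) (fun i => hV (hh i))
    fun i => hV (hk i))

theorem Implements.hasCore {Γ : UnitaryGroup E} (hΓ : Implements Γ U ρ Ω)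
    (hcyc : Dense (Set.range fun x => ρ x Ω)) {V : Submodule ℂ H} (hV : Dense (V : Set H))
    (hdom : V ≤ U.generator.domain) (hinv : ∀ t : ℝ, ∀ v ∈ V, U t v ∈ V) :
    Γ.generator.HasCore (monomialSpan ρ Ω V) :=
  Γ.hasCore_generator (dense_monomialSpan hcyc hV) (hΓ.monomialSpan_le_domain hdom)
    fun t _ hx => hΓ.map_mem_monomialSpan hinv t hx

end Implementation

end GICAR

end

theorem proposition4p1 {H : Type*} [NormedAddCommGroup H] [InnerProductSpace ℂ H] [CompleteSpace H]
    (K : H →L[ℂ] H) (hK₀ : 0 ≤ K) (hK₁ : K ≤ 1)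
    (A : H →ₗ.[ℂ] H) (hA : IsSelfAdjoint A) (hAK : GICAR.Commutes A K)
    (U : GICAR.UnitaryGroup H) (hU : U.generator = A)
    {E : Type*} [NormedAddCommGroup E] [InnerProductSpace ℂ E] [CompleteSpace E]
    (ρ : GICAR.gicar H →⋆ₐ[ℂ] (E →L[ℂ] E)) (Ω : E)
    (hρ : GICAR.IsGNSTriple (GICAR.gicarState K hK₀ hK₁) ρ Ω) :
    (∃! Γ : GICAR.UnitaryGroup E, GICAR.Implements Γ U ρ Ω) ∧
    ∀ Γ : GICAR.UnitaryGroup E, GICAR.Implements Γ U ρ Ω →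
      ∀ V : Submodule ℂ H, Dense (V : Set H) → V ≤ A.domain → (∀ t : ℝ, ∀ v ∈ V, U t v ∈ V) →
        Γ.generator.HasCore (GICAR.monomialSpan ρ Ω V) := by
  subst hU
  have hcomm := hAK.map_apply hA.dense_domain
  have hinvariant (t : ℝ) := GICAR.gicarState_bogoliubov hK₀ hK₁ (hcomm t)
  exact ⟨hρ.existsUnique_implements hinvariant,
    fun Γ hΓ V hV hdom hinv => hΓ.hasCore hρ.cyclic hV hdom hinv⟩
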